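/- Let $p$ be a prime number. (1) Let $k$ be a field, let $0\le r\le n$ be integers, and let $$R=k\left[X_1^{1/p^\infty},\dots,X_r^{1/p^\infty},X_{r+1}^{\pm1/p^\infty},\dots,X_n^{\pm1/p^\infty}\right],$$ the $k$-algebra of finite sums $\sum_\alpha a_\alpha X^\alpha$ with $a_\alpha\in k$ and exponents $\alpha\in\mathbb Z[1/p]^n$ satisfying $\alpha_1,\dots,\alpha_r\ge 0$. Then every finite (i.e. finitely generated) projective $R$-module is free. (2) Let $K$ be a perfectoid field of residue characteristic $p$, let $n\ge 0$, and let $$T=K\left\langle X_1^{1/p^\infty},\dots,X_n^{1/p^\infty}\right\rangle$$ be the perfectoid Tate algebra, that is, the completion, for the Gauss norm $\left\|\sum_\alpha a_\alpha X^\alpha\right\|=\sup_\alpha|a_\alpha|$, of the union $\bigcup_{m\ge0}K\langle X_1^{1/p^m},\dots,X_n^{1/p^m}\rangle$ of Tate algebras. Let $T^\circ\subseteq T$ be the subring of power-bounded elements and $T^{\circ\circ}\subseteq T^\circ$ the ideal of topologically nilpotent elements. Then every finite projective module over the residue ring $\tilde T=T^\circ/T^{\circ\circ}$ is free. -/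

import Mathlib

noncomputable section

namespace PerfQS

open Filter Topology MvPowerSeries

/-! ### The ring `k[X_1^{1/p^∞}, …, X_r^{1/p^∞}, X_{r+1}^{±1/p^∞}, …, X_n^{±1/p^∞}]` -/

/-- The monoid of exponents: vectors `α ∈ ℤ[1/p]^n` whose first `r` coordinates are nonnegative. -/
def exponents (p n r : ℕ) : AddSubmonoid (Fin n → ℚ) where
  carrier := {α | ∀ i : Fin n,
    (∃ (m : ℕ) (z : ℤ), (p : ℚ) ^ m * α i = z) ∧ ((i : ℕ) < r → 0 ≤ α i)}
  zero_mem' := fun _ => ⟨⟨0, 0, by simp⟩, fun _ => le_rfl⟩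
  add_mem' := by
    intro α β hα hβ i
    obtain ⟨⟨m, z, hz⟩, h1⟩ := hα i
    obtain ⟨⟨l, w, hw⟩, h2⟩ := hβ i
    refine ⟨⟨m + l, p ^ l * z + p ^ m * w, ?_⟩, fun hi => add_nonneg (h1 hi) (h2 hi)⟩
    push_cast
    rw [← hz, ← hw, Pi.add_apply]
    ring

/-- Finite sums `∑ a_α X^α` with coefficients in `k` and exponents in `exponents p n r`. -/
abbrev PerfLaurent (k : Type*) [Field k] (p n r : ℕ) : Type _ :=
  AddMonoidAlgebra k (exponents p n r)

/-! ### Power-bounded and topologically nilpotent elements, residue rings -/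

section PowerBounded

variable {R : Type*} [CommRing R] [TopologicalSpace R]

/-- `a` is power-bounded: the set of its powers `{a ^ j}` is a bounded subset of the topological
ring `R`. -/
def IsPowerBounded (a : R) : Prop :=
  ∀ U ∈ 𝓝 (0 : R), ∃ V ∈ 𝓝 (0 : R), ∀ v ∈ V, ∀ j : ℕ, v * a ^ j ∈ U

theorem IsPowerBounded.mul {a b : R} (ha : IsPowerBounded a) (hb : IsPowerBounded b) :
    IsPowerBounded (a * b) := by
  intro U hU
  obtain ⟨V, hV, h1⟩ := hb U hU
  obtain ⟨W, hW, h2⟩ := ha V hV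
  refine ⟨W, hW, fun v hv j => ?_⟩
  rw [mul_pow, ← mul_assoc]
  exact h1 _ (h2 v hv j) j

theorem IsPowerBounded.add [NonarchimedeanRing R] {a b : R} (ha : IsPowerBounded a)
    (hb : IsPowerBounded b) : IsPowerBounded (a + b) := by
  intro U hU
  obtain ⟨G, hG⟩ := NonarchimedeanRing.is_nonarchimedean U hU
  obtain ⟨V, hV, h1⟩ := hb G G.mem_nhds_zero
  obtain ⟨W, hW, h2⟩ := ha V hV
  refine ⟨W, hW, fun v hv j => hG ?_⟩
  change v * (a + b) ^ j ∈ G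
  rw [add_pow, Finset.mul_sum]
  refine sum_mem fun i _ => ?_
  rw [← mul_assoc, ← mul_assoc, mul_comm _ ((j.choose i : ℕ) : R), ← nsmul_eq_mul]
  exact nsmul_mem (h1 _ (h2 v hv i) _) _

theorem IsPowerBounded.neg [NonarchimedeanRing R] {a : R} (ha : IsPowerBounded a) :
    IsPowerBounded (-a) := by
  intro U hU
  obtain ⟨G, hG⟩ := NonarchimedeanRing.is_nonarchimedean U hU
  obtain ⟨V, hV, h1⟩ := ha G G.mem_nhds_zero
  refine ⟨V, hV, fun v hv j => hG ?_⟩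
  change v * (-a) ^ j ∈ G
  rcases Nat.even_or_odd j with h | h
  · rw [h.neg_pow]
    exact h1 v hv j
  · rw [h.neg_pow, mul_neg]
    exact neg_mem (h1 v hv j)

theorem IsPowerBounded.of_isTopologicallyNilpotent [IsTopologicalRing R] {a : R}
    (ha : IsTopologicallyNilpotent a) : IsPowerBounded a := by
  intro U hU
  have hm : Tendsto (fun x : R × R => x.1 * x.2) (𝓝 0 ×ˢ 𝓝 0) (𝓝 0) := by
    simpa [nhds_prod_eq] using (continuous_mul (M := R)).tendsto (0, 0)
  obtain ⟨A, hA, B, hB, hAB⟩ := mem_prod_iff.1 (hm hU)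
  obtain ⟨N, hN⟩ := eventually_atTop.1 (ha.eventually hB)
  have hfin : ∀ᶠ v in 𝓝 (0 : R), ∀ j ∈ Finset.range N, v * a ^ j ∈ U := by
    rw [eventually_all_finset]
    intro j _
    have : Tendsto (fun v : R => v * a ^ j) (𝓝 0) (𝓝 0) := by
      simpa using (continuous_mul_const (a ^ j)).tendsto (0 : R)
    exact this.eventually hU
  refine ⟨A ∩ {v | ∀ j ∈ Finset.range N, v * a ^ j ∈ U}, inter_mem hA hfin, fun v hv j => ?_⟩
  by_cases h : N ≤ j
  · exact hAB (Set.mk_mem_prod hv.1 (hN j h))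
  · exact hv.2 j (Finset.mem_range.2 (not_le.1 h))

theorem IsPowerBounded.add_isTopologicallyNilpotent [NonarchimedeanRing R] {a b : R}
    (ha : IsPowerBounded a) (hb : IsPowerBounded b) (ha' : IsTopologicallyNilpotent a)
    (hb' : IsTopologicallyNilpotent b) : IsTopologicallyNilpotent (a + b) := by
  intro U hU
  obtain ⟨G, hG⟩ := NonarchimedeanRing.is_nonarchimedean U hU
  obtain ⟨V, hV, h1⟩ := ha G G.mem_nhds_zero
  obtain ⟨W, hW, h2⟩ := hb G G.mem_nhds_zero
  obtain ⟨N, hN⟩ := eventually_atTop.1 (ha'.eventually hW)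
  obtain ⟨M, hM⟩ := eventually_atTop.1 (hb'.eventually hV)
  refine eventually_atTop.2 ⟨N + M, fun j hj => hG ?_⟩
  change (a + b) ^ j ∈ G
  rw [add_pow]
  refine sum_mem fun i _ => ?_
  rw [mul_comm _ ((j.choose i : ℕ) : R), ← nsmul_eq_mul]
  refine nsmul_mem ?_ _
  by_cases h : N ≤ i
  · exact h2 _ (hN i h) _
  · rw [mul_comm]
    exact h1 _ (hM (j - i) (by omega)) _

variable (R) [NonarchimedeanRing R]

/-- The subring `R°` of power-bounded elements. -/
def powerBounded : Subring R where
  carrier := {a | IsPowerBounded a}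
  zero_mem' := fun U hU => ⟨U, hU, fun v hv j => by
    rcases Nat.eq_zero_or_pos j with rfl | hj
    · simpa using hv
    · simpa [hj.ne'] using mem_of_mem_nhds hU⟩
  one_mem' := fun U hU => ⟨U, hU, fun v hv j => by simpa using hv⟩
  add_mem' := IsPowerBounded.add
  mul_mem' := IsPowerBounded.mul
  neg_mem' := IsPowerBounded.neg

/-- The ideal `R°°` of `R°` consisting of the topologically nilpotent elements. -/
def topNilpotent : Ideal (powerBounded R) where
  carrier := {a | IsTopologicallyNilpotent (a : R)}
  zero_mem' := IsTopologicallyNilpotent.zero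
  add_mem' := fun {a b} ha hb =>
    IsPowerBounded.add_isTopologicallyNilpotent a.2 b.2 ha hb
  smul_mem' := by
    intro c a ha U hU
    obtain ⟨V, hV, h1⟩ := c.2 U hU
    refine (Tendsto.eventually (f := fun j : ℕ => (a : R) ^ j) ha hV).mono fun j hj => ?_
    have := h1 _ hj j
    rw [mul_comm] at this
    simpa [mul_pow] using this

/-- The residue ring `R° / R°°`. Every topologically nilpotent element is power-bounded, see
`IsPowerBounded.of_isTopologicallyNilpotent`. -/
abbrev ResidueRing : Type _ := powerBounded R ⧸ topNilpotent R

end PowerBounded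

/-! ### Perfectoid fields -/

/-- A nontrivially normed nonarchimedean field `K` is perfectoid (of residue characteristic `p`) if
it is complete, its residue field has characteristic `p`, its value group is not discrete, and the
Frobenius map `K° / p K° → K° / p K°` is surjective. -/
structure IsPerfectoidField (p : ℕ) (K : Type*) [NontriviallyNormedField K]
    [IsUltrametricDist K] : Prop where
  complete : CompleteSpace K
  norm_p_lt_one : ‖(p : K)‖ < 1
  nondiscrete : ∀ ε < (1 : ℝ), ∃ x : K, ε < ‖x‖ ∧ ‖x‖ < 1
  frobenius_surjective : ∀ x : K, ‖x‖ ≤ 1 → ∃ y : K, ‖y‖ ≤ 1 ∧ ∃ z : K, ‖z‖ ≤ 1 ∧ x = y ^ p + p * z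

/-! ### The perfectoid Tate algebra -/

section Tate

variable (K : Type*) [NontriviallyNormedField K] [IsUltrametricDist K] (n : ℕ)

/-- The Tate algebra `K⟨X_1, …, X_n⟩`: power series whose coefficients tend to zero. -/
abbrev TateAlgebra : Type _ := IsRestricted.subring (R := K) (1 : Fin n → ℝ)

set_option linter.unusedSectionVars false

variable {K n}

theorem tendsto_coeff (f : TateAlgebra K n) :
    Tendsto (fun t => ‖coeff t (f : MvPowerSeries (Fin n) K)‖) cofinite (𝓝 0) := by
  have := f.2
  change IsRestricted _ _ at this
  simpa [IsRestricted, Finsupp.prod] using this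

/-- The Gauss norm, `sup |a_α|`. -/
def gauss (f : TateAlgebra K n) : ℝ := gaussNorm (‖·‖) (1 : Fin n → ℝ) (f : MvPowerSeries (Fin n) K)

theorem gauss_eq (f : TateAlgebra K n) :
    gauss f = ⨆ t, ‖coeff t (f : MvPowerSeries (Fin n) K)‖ := by
  simp [gauss, gaussNorm, Finsupp.prod]

theorem hasGaussNorm (f : TateAlgebra K n) :
    HasGaussNorm (‖·‖) (1 : Fin n → ℝ) (f : MvPowerSeries (Fin n) K) := by
  have := (tendsto_coeff f).bddAbove_range_of_cofinite
  simpa [HasGaussNorm, Finsupp.prod] using this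

instance : NormedAddCommGroup (TateAlgebra K n) :=
  AddGroupNorm.toNormedAddCommGroup
    { toFun := gauss
      map_zero' := gaussNorm_zero _ _ norm_zero
      add_le' := fun f g => (gaussNorm_add_le_max _ _ _ _ zero_le_one (fun _ => norm_nonneg _)
          IsUltrametricDist.isNonarchimedean_norm (hasGaussNorm f) (hasGaussNorm g)).trans
        (max_le_add_of_nonneg (gaussNorm_nonneg _ _ _ fun _ => norm_nonneg _)
          (gaussNorm_nonneg _ _ _ fun _ => norm_nonneg _))
      neg' := fun f => gaussNorm_neg _ _ norm_neg _
      eq_zero_of_map_eq_zero' := fun _ hf => Subtype.ext <|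
        (gaussNorm_eq_zero_iff _ _ _ norm_zero (fun _ => norm_nonneg _)
          (fun _ => norm_eq_zero.1) (fun _ => one_pos) (hasGaussNorm _)).1 hf }

instance : NormedCommRing (TateAlgebra K n) :=
  { (inferInstance : NormedAddCommGroup (TateAlgebra K n)),
    (inferInstance : CommRing (TateAlgebra K n)) with
    norm_mul_le := fun f g => gaussNorm_mul_le _ _ _ _ zero_le_one (fun _ => norm_nonneg _)
      (fun a b => (norm_mul a b).le) IsUltrametricDist.isNonarchimedean_norm norm_zero
      (hasGaussNorm f) (hasGaussNorm g) }

theorem norm_def (f : TateAlgebra K n) : ‖f‖ = gauss f := rfl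

theorem norm_add_le_max' (f g : TateAlgebra K n) : ‖f + g‖ ≤ max ‖f‖ ‖g‖ :=
  gaussNorm_add_le_max _ _ _ _ zero_le_one (fun _ => norm_nonneg _)
    IsUltrametricDist.isNonarchimedean_norm (hasGaussNorm f) (hasGaussNorm g)

theorem coeff_expand_eq {q : ℕ} (hq : q ≠ 0) (f : MvPowerSeries (Fin n) K) (t : Fin n →₀ ℕ) :
    (∃ s, t = q • s ∧ coeff t (expand q hq f) = coeff s f) ∨ coeff t (expand q hq f) = 0 := by
  by_cases h : ∀ i, q ∣ t i
  · refine Or.inl ⟨t.mapRange (· / q) (Nat.zero_div q), ?_, ?_⟩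
    · ext i
      simp [Nat.mul_div_cancel' (h i)]
    · conv_lhs => rw [show t = q • t.mapRange (· / q) (Nat.zero_div q) by
        ext i; simp [Nat.mul_div_cancel' (h i)]]
      rw [coeff_expand_smul]
  · push Not at h
    exact Or.inr (coeff_expand_of_not_dvd q hq f h.choose_spec)

theorem isRestricted_expand {q : ℕ} (hq : q ≠ 0) (f : TateAlgebra K n) :
    expand q hq (f : MvPowerSeries (Fin n) K) ∈ IsRestricted.subring (R := K) (1 : Fin n → ℝ) := by
  have hf := tendsto_coeff f
  suffices h : Tendsto (fun t => ‖coeff t (expand q hq (f : MvPowerSeries (Fin n) K))‖)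
      cofinite (𝓝 0) by
    change IsRestricted _ _
    simpa [IsRestricted, Finsupp.prod] using h
  rw [Metric.tendsto_nhds] at hf ⊢
  intro ε hε
  have := hf ε hε
  rw [eventually_cofinite] at this ⊢
  refine (this.image (q • ·)).subset fun t ht => ?_
  rcases coeff_expand_eq hq (f : MvPowerSeries (Fin n) K) t with ⟨s, rfl, hs⟩ | h0
  · refine ⟨s, ?_, rfl⟩
    rwa [Set.mem_ofPred_eq, hs] at ht
  · rw [Set.mem_ofPred_eq, h0, norm_zero, dist_self] at ht
    exact absurd hε ht

variable (K n) (p : ℕ) [hp : Fact p.Prime]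

/-- The map `f(X_1, …, X_n) ↦ f(X_1^{p^(j-i)}, …, X_n^{p^(j-i)})`. Writing the `i`-th copy of the Tate
algebra as `K⟨X_1^{1/p^i}, …, X_n^{1/p^i}⟩`, it is the inclusion of the `i`-th into the `j`-th. -/
def transition (i j : ℕ) (_ : i ≤ j) : TateAlgebra K n →+* TateAlgebra K n :=
  RingHom.codRestrict
    ((expand (p ^ (j - i)) (pow_ne_zero _ hp.out.ne_zero) :
      MvPowerSeries (Fin n) K →ₐ[K] MvPowerSeries (Fin n) K).toRingHom.comp
        (IsRestricted.subring (R := K) (1 : Fin n → ℝ)).subtype) _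
    fun f => isRestricted_expand (pow_ne_zero _ hp.out.ne_zero) f

theorem coe_transition (i j : ℕ) (h : i ≤ j) (f : TateAlgebra K n) :
    (transition K n p i j h f : MvPowerSeries (Fin n) K) =
      expand (p ^ (j - i)) (pow_ne_zero _ hp.out.ne_zero) (f : MvPowerSeries (Fin n) K) := rfl

theorem norm_transition (i j : ℕ) (h : i ≤ j) (f : TateAlgebra K n) :
    ‖transition K n p i j h f‖ = ‖f‖ := by
  have hq := pow_ne_zero (j - i) hp.out.ne_zero
  have b1 : BddAbove (Set.range fun t => ‖coeff t (f : MvPowerSeries (Fin n) K)‖) :=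
    (tendsto_coeff f).bddAbove_range_of_cofinite
  have b2 := (tendsto_coeff (transition K n p i j h f)).bddAbove_range_of_cofinite
  rw [norm_def, norm_def, gauss_eq, gauss_eq]
  refine le_antisymm (ciSup_le fun t => ?_) (ciSup_le fun s => ?_)
  · rw [coe_transition]
    rcases coeff_expand_eq hq (f : MvPowerSeries (Fin n) K) t with ⟨s, rfl, hs⟩ | h0
    · rw [hs]
      exact le_ciSup b1 s
    · rw [h0, norm_zero]
      exact (norm_nonneg _).trans (le_ciSup b1 0)
  · refine le_trans (le_of_eq ?_) (le_ciSup b2 (p ^ (j - i) • s))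
    rw [coe_transition, coeff_expand_smul]

instance : DirectedSystem (fun _ : ℕ => TateAlgebra K n) (transition K n p · · ·) where
  map_self i f := by
    apply Subtype.ext
    rw [coe_transition]
    simp
  map_map i j l hij hjl f := by
    apply Subtype.ext
    rw [coe_transition, coe_transition, coe_transition, ← expand_mul]
    congr 2
    rw [← pow_add]
    congr 1
    omega

/-- The union `⋃_m K⟨X_1^{1/p^m}, …, X_n^{1/p^m}⟩`. -/
def TateUnion : Type _ :=
  DirectLimit (fun _ : ℕ => TateAlgebra K n) (transition K n p)

instance : CommRing (TateUnion K n p) :=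
  inferInstanceAs (CommRing (DirectLimit (fun _ : ℕ => TateAlgebra K n) (transition K n p)))

/-- The Gauss norm on the union; on each of the Tate algebras it is the Gauss norm. -/
def unionNorm : TateUnion K n p → ℝ :=
  DirectLimit.lift (transition K n p) (fun _ f => ‖f‖) fun i j h f => (norm_transition K n p i j h f).symm

instance : NormedAddCommGroup (TateUnion K n p) :=
  AddGroupNorm.toNormedAddCommGroup
    { toFun := unionNorm K n p
      map_zero' := by
        change unionNorm K n p (0 : DirectLimit _ (transition K n p)) = 0
        rw [DirectLimit.zero_def 0]
        exact norm_zero (E := TateAlgebra K n)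
      add_le' := DirectLimit.induction₂ (transition K n p) fun i f g =>
        (congrArg (unionNorm K n p) (DirectLimit.add_def i f g)).trans_le (norm_add_le f g)
      neg' := DirectLimit.induction (transition K n p) fun i f => by
        refine (congrArg (unionNorm K n p)
          (DirectLimit.neg_def (f := transition K n p) i f)).trans ?_
        exact norm_neg (E := TateAlgebra K n) f
      eq_zero_of_map_eq_zero' := DirectLimit.induction (transition K n p) fun i f hf => by
        have : f = 0 := norm_eq_zero.1 hf
        rw [this]
        exact (DirectLimit.zero_def i).symm }

instance : NormedCommRing (TateUnion K n p) :=
  { (inferInstance : NormedAddCommGroup (TateUnion K n p)),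
    (inferInstance : CommRing (TateUnion K n p)) with
    norm_mul_le := DirectLimit.induction₂ (transition K n p) fun i f g =>
      (congrArg (unionNorm K n p) (DirectLimit.mul_def i f g)).trans_le (norm_mul_le f g) }

instance : IsUltrametricDist (TateUnion K n p) :=
  IsUltrametricDist.isUltrametricDist_of_forall_norm_add_le_max_norm <|
    DirectLimit.induction₂ (transition K n p) fun i f g =>
      (congrArg (unionNorm K n p) (DirectLimit.add_def i f g)).trans_le (norm_add_le_max' f g)

instance : NonarchimedeanRing (TateUnion K n p) where
  toIsTopologicalRing := inferInstance
  is_nonarchimedean :=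
    (IsUltrametricDist.nonarchimedeanAddGroup (M := TateUnion K n p)).is_nonarchimedean

/-- The perfectoid Tate algebra `K⟨X_1^{1/p^∞}, …, X_n^{1/p^∞}⟩`. -/
abbrev PerfTateAlgebra : Type _ := UniformSpace.Completion (TateUnion K n p)

end Tate

end PerfQS

end

/-!
Freeness of finite projective modules over a ring `R` is used throughout in the form
`IdempotentsSplit R`: every idempotent matrix over `R` is a product `A * B` with `B * A = 1`. In
this form it passes to directed unions of rings (`IdempotentsSplit.of_finite_subsets`), since a
matrix has finitely many entries. Both rings of the theorem are directed unions over `m` of rings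
of polynomials, or Laurent polynomials, in the `p ^ m`-th roots of the variables.

For polynomials over a field the property is the Quillen–Suslin theorem
(`IdempotentsSplit.mvPolynomial`), proved by induction on the number of variables. The image `P`
of an idempotent over `A[X]` contains, after clearing denominators, a free module `F` with `P / F`
killed by a nonzero polynomial, and Nagata's change of variables makes this polynomial monic
(`MonicCoordinates.polynomial`). Then `P / F` is finite over `A`, and since projective `A`-modules
are free by induction, Schanuel's lemma over `A` and over `A[X]` shows that `P` is stably free
(`exists_free_prod_of_monic`). It remains to complete unimodular vectors over `A[X]`. After a
change of variables such a vector has a monic entry; over `A[X]` with `A` local it is then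
equivalent to a basis vector by Horrocks' theorem (`VecEquiv.single_of_monic`), and Quillen's
patching makes it equivalent to its value at `0` for any domain `A` (`VecEquiv.eval_zero_of_monic`),
so that induction applies.

A Laurent variable `y` is adjoined to `k[H]` in `IdempotentsSplit.prod_int`. The hypothesis for
the field `k(y)` splits an idempotent over `k[y, y⁻¹][H]` after inverting some `g(y)` with
`g(0) ≠ 0`. As `y` and `g` generate the unit ideal of `k[y]`, the projective module glues with a free one
to a projective module over `k[y][H]`, which is free.

For the perfectoid Tate algebra, multiplicativity of the Gauss norm (`TateAlgebra.norm_mul_eq`)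
identifies the power-bounded elements with the closed unit ball and the topologically nilpotent
ones with the open unit ball. Every element of norm at most `1` differs by one of norm less than
`1` from a polynomial in the `X_i^{1/p^m}` with integral coefficients, so that the residue ring is
the union of polynomial rings over the residue field of `K` (`IdempotentsSplit.residueRing`).
-/

noncomputable section

namespace PerfQS

universe u

/-! ### Splitting idempotent matrices -/

section Splitting

open Matrix

/-- Every idempotent matrix `e` over `R` factors as `e = A * B` with `B * A = 1`. The columns of
`A` are then a basis of the image of `e`, so this says that finite projective `R`-modules are free
(`IdempotentsSplit.free`, `IdempotentsSplit.of_free`), in a form that is independent of universes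
and can be transported along ring homomorphisms. -/
def IdempotentsSplit (R : Type*) [CommRing R] : Prop :=
  ∀ (n : ℕ) (e : Matrix (Fin n) (Fin n) R), e * e = e →
    ∃ (r : ℕ) (A : Matrix (Fin n) (Fin r) R) (B : Matrix (Fin r) (Fin n) R), A * B = e ∧ B * A = 1

theorem IdempotentsSplit.of_fintype {R : Type*} [CommRing R] (h : IdempotentsSplit R)
    {ι : Type*} [Fintype ι] [DecidableEq ι] (e : Matrix ι ι R) (he : e * e = e) :
    ∃ (r : ℕ) (A : Matrix ι (Fin r) R) (B : Matrix (Fin r) ι R), A * B = e ∧ B * A = 1 := by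
  let σ := Fintype.equivFin ι
  obtain ⟨r, A, B, h1, h2⟩ := h _ (e.submatrix σ.symm σ.symm) (by
    rw [submatrix_mul_equiv, he])
  refine ⟨r, A.submatrix σ id, B.submatrix id σ, ?_, ?_⟩
  · rw [← submatrix_mul A B σ id σ Function.bijective_id, h1]
    ext i j
    simp
  · rw [submatrix_mul_equiv, h2]
    simp

theorem IdempotentsSplit.free {R : Type*} [CommRing R] (h : IdempotentsSplit R)
    (M : Type*) [AddCommGroup M] [Module R M] [Module.Finite R M] [Module.Projective R M] :
    Module.Free R M := by
  obtain ⟨n, p, s, -, -, hps⟩ := Module.Finite.exists_comp_eq_id_of_projective R M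
  have hps' : ∀ x, p (s x) = x := fun x => LinearMap.congr_fun hps x
  obtain ⟨r, A, B, h1, h2⟩ := h n (LinearMap.toMatrix' (s ∘ₗ p)) (by
    rw [← LinearMap.toMatrix'_comp]
    congr 1
    ext x
    simp [hps'])
  have hAB : ∀ x, A *ᵥ (B *ᵥ x) = s (p x) := fun x => by
    rw [mulVec_mulVec, h1, LinearMap.toMatrix'_mulVec]
    rfl
  have hBA : ∀ x, B *ᵥ (A *ᵥ x) = x := fun x => by rw [mulVec_mulVec, h2, one_mulVec]
  refine Module.Free.of_equiv (LinearEquiv.ofLinearMap (p ∘ₗ A.mulVecLin) (B.mulVecLin ∘ₗ s) ?_ ?_)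
  · ext x
    simp [hAB, hps']
  · refine LinearMap.ext fun x => ?_
    have : s (p (A *ᵥ x)) = A *ᵥ x := by rw [← hAB, hBA]
    simp [this, hBA]

theorem mulVec_eq_self_of_mem_range {R : Type*} [CommRing R] {n : ℕ}
    {e : Matrix (Fin n) (Fin n) R} (he : e * e = e) {x : Fin n → R}
    (hx : x ∈ LinearMap.range e.mulVecLin) : e *ᵥ x = x := by
  obtain ⟨y, rfl⟩ := hx
  simp [mulVec_mulVec, he]

theorem projective_range {R : Type*} [CommRing R] {n : ℕ} {e : Matrix (Fin n) (Fin n) R}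
    (he : e * e = e) : Module.Projective R (LinearMap.range e.mulVecLin) := by
  refine Module.Projective.of_split (LinearMap.range e.mulVecLin).subtype
    e.mulVecLin.rangeRestrict ?_
  ext ⟨x, hx⟩ : 2
  simpa using mulVec_eq_self_of_mem_range he hx

theorem exists_split_of_free_range {R : Type*} [CommRing R] {n : ℕ} (e : Matrix (Fin n) (Fin n) R)
    (he : e * e = e) [Module.Free R (LinearMap.range e.mulVecLin)] :
    ∃ (r : ℕ) (A : Matrix (Fin n) (Fin r) R) (B : Matrix (Fin r) (Fin n) R),
      A * B = e ∧ B * A = 1 := by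
  rcases subsingleton_or_nontrivial R with hR | hR
  · exact ⟨0, 0, 0, Subsingleton.elim _ _, Subsingleton.elim _ _⟩
  let P := LinearMap.range e.mulVecLin
  have hsec : e.mulVecLin.rangeRestrict ∘ₗ P.subtype = LinearMap.id := by
    ext ⟨x, hx⟩ : 2
    simpa using mulVec_eq_self_of_mem_range he hx
  let b := Module.finBasis R P
  let f : (Fin (Module.finrank R P) → R) →ₗ[R] (Fin n → R) := P.subtype ∘ₗ b.equivFun.symm
  let g : (Fin n → R) →ₗ[R] (Fin (Module.finrank R P) → R) :=
    b.equivFun ∘ₗ e.mulVecLin.rangeRestrict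
  refine ⟨_, LinearMap.toMatrix' f, LinearMap.toMatrix' g, ?_, ?_⟩
  · rw [← LinearMap.toMatrix'_comp]
    have : f ∘ₗ g = e.mulVecLin := by
      refine LinearMap.ext fun x => ?_
      simp [f, g]
    rw [this, ← Matrix.toLin'_apply', LinearMap.toMatrix'_toLin']
  · rw [← LinearMap.toMatrix'_comp]
    have : g ∘ₗ f = LinearMap.id := by
      refine LinearMap.ext fun x => ?_
      have := LinearMap.congr_fun hsec (b.equivFun.symm x)
      simp only [LinearMap.comp_apply, LinearMap.id_apply] at this
      simp only [f, g, LinearMap.comp_apply, LinearEquiv.coe_coe, LinearMap.id_apply]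
      rw [this, LinearEquiv.apply_symm_apply]
    rw [this, LinearMap.toMatrix'_id]

theorem IdempotentsSplit.of_free {R : Type u} [CommRing R]
    (h : ∀ (M : Type u) [AddCommGroup M] [Module R M] [Module.Finite R M] [Module.Projective R M],
      Module.Free R M) : IdempotentsSplit R := by
  intro n e he
  have := projective_range he
  have := h (LinearMap.range e.mulVecLin)
  exact exists_split_of_free_range e he

theorem IdempotentsSplit.of_field (k : Type*) [Field k] : IdempotentsSplit k :=
  IdempotentsSplit.of_free fun _ => inferInstance

theorem IdempotentsSplit.of_ringEquiv {R S : Type*} [CommRing R] [CommRing S]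
    (h : IdempotentsSplit S) (φ : S ≃+* R) : IdempotentsSplit R := by
  intro n e he
  obtain ⟨r, A, B, h1, h2⟩ := h n (e.map φ.symm) (by rw [← Matrix.map_mul, he])
  refine ⟨r, A.map φ, B.map φ, ?_, ?_⟩
  · rw [← Matrix.map_mul, h1]
    ext i j
    simp
  · rw [← Matrix.map_mul, h2, Matrix.map_one _ (map_zero φ) (map_one φ)]

/-- Splitting of idempotents passes to directed unions: an idempotent matrix has finitely many
entries. -/
theorem IdempotentsSplit.of_finite_subsets {R : Type*} [CommRing R]
    (h : ∀ s : Finset R, ∃ (S : Type u) (_ : CommRing S) (φ : S →+* R), Function.Injective φ ∧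
      IdempotentsSplit S ∧ ∀ x ∈ s, x ∈ φ.range) : IdempotentsSplit R := by
  classical
  intro n e he
  obtain ⟨S, _, φ, hφ, hS, hs⟩ := h (Finset.univ.image fun ij : Fin n × Fin n => e ij.1 ij.2)
  have hs' : ∀ i j, ∃ y, φ y = e i j := fun i j =>
    hs _ (Finset.mem_image.2 ⟨(i, j), Finset.mem_univ _, rfl⟩)
  choose e' he' using hs'
  have hmap : (Matrix.of e').map φ = e := by
    ext i j
    exact he' i j
  obtain ⟨r, A, B, h1, h2⟩ := hS n (Matrix.of e') (by
    apply Matrix.map_injective hφ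
    beta_reduce
    rw [Matrix.map_mul, hmap, he])
  refine ⟨r, A.map φ, B.map φ, ?_, ?_⟩
  · rw [← Matrix.map_mul, h1, hmap]
  · rw [← Matrix.map_mul, h2, Matrix.map_one _ (map_zero φ) (map_one φ)]

/-- Gluing over the cover of `Spec S` by the loci `y ≠ 0` and `g ≠ 0`. Let `R = S[1/y]` and let `e`
be an idempotent over `R` whose image becomes free after inverting an element `g` of `S` coprime
to `y`. Gluing the image of `e` with a free module extends it to a projective `S`-module, so that
it is free if projective `S`-modules are. -/
theorem IdempotentsSplit.exists_split_of_isCoprime {R S : Type*} [CommRing R] [CommRing S]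
    (hS : IdempotentsSplit S) (φ : S →+* R) (hφ : Function.Injective φ) (y : S)
    (hy : ∀ x : R, ∃ N : ℕ, φ y ^ N * x ∈ φ.range) {n r : ℕ}
    (e : Matrix (Fin n) (Fin n) R) (he : e * e = e) (A : Matrix (Fin n) (Fin r) R)
    (B : Matrix (Fin r) (Fin n) R) (g : S) (hg : IsCoprime y g) (hAB : A * B = φ g • e)
    (hBA : B * A = φ g • 1) (hA : e * A = A) (hB : B * e = B) :
    ∃ (r : ℕ) (A : Matrix (Fin n) (Fin r) R) (B : Matrix (Fin r) (Fin n) R),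
      A * B = e ∧ B * A = 1 := by
  classical
  have hmono : ∀ (N M : ℕ) (x : R), N ≤ M → φ y ^ N * x ∈ φ.range → φ y ^ M * x ∈ φ.range := by
    intro N M x hNM hx
    rw [← Nat.sub_add_cancel hNM, pow_add, mul_assoc]
    exact mul_mem (pow_mem (φ.mem_range_self y) _) hx
  have hfin : ∀ {ι κ : Type} [Fintype ι] [Fintype κ] (C : Matrix ι κ R),
      ∃ N : ℕ, ∀ M, N ≤ M → ∀ i j, φ y ^ M * C i j ∈ φ.range := by
    intro ι κ _ _ C
    choose N hN using fun i j => hy (C i j)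
    refine ⟨∑ i, ∑ j, N i j, fun M hM i j => hmono (N i j) _ _ ?_ (hN i j)⟩
    refine le_trans ?_ hM
    exact (Finset.single_le_sum (f := fun j => N i j) (fun _ _ => Nat.zero_le _)
      (Finset.mem_univ j)).trans (Finset.single_le_sum (f := fun i => ∑ j, N i j)
      (fun _ _ => Nat.zero_le _) (Finset.mem_univ i))
  obtain ⟨N₁, h1⟩ := hfin A
  obtain ⟨N₂, h2⟩ := hfin B
  obtain ⟨N₃, h3⟩ := hfin e
  set M := N₁ + N₂ + N₃ with hM
  replace h1 := h1 M (by omega)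
  replace h2 := h2 M (by omega)
  replace h3 := h3 M (by omega)
  obtain ⟨u, v, huv⟩ : IsCoprime (y ^ (M + M)) g := hg.pow_left
  have huv' : φ u * (φ y ^ M * φ y ^ M) + φ v * φ g = 1 := by
    rw [← pow_add, ← map_pow, ← map_mul, ← map_mul, ← map_add, huv, map_one]
  -- `e` is a retract of `e' = L * Q`, which has entries in `S`
  let L : Matrix (Fin r ⊕ Fin n) (Fin n) R := fromRows B (φ y ^ M • e)
  let Q : Matrix (Fin n) (Fin r ⊕ Fin n) R := fromCols (φ v • A) ((φ u * φ y ^ M) • e)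
  have hQL : Q * L = e := by
    simp only [Q, L, fromCols_mul_fromRows, Matrix.smul_mul, Matrix.mul_smul, hAB, he, smul_smul]
    rw [← add_smul]
    have : φ v * φ g + φ y ^ M * (φ u * φ y ^ M) = 1 := by rw [← huv']; ring
    rw [this, one_smul]
  have hLe : L * e = L := by
    simp only [L, fromRows_mul, Matrix.smul_mul, hB, he]
  have hLQ : L * Q = fromBlocks ((φ v * φ g) • 1) (φ u • φ y ^ M • B)
      (φ v • φ y ^ M • A) ((φ u * φ y ^ M) • φ y ^ M • e) := by
    simp only [Q, L, fromRows_mul_fromCols, Matrix.smul_mul, Matrix.mul_smul, hBA, he, hA, hB,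
      smul_smul]
  have hrange : ∀ i j, ∃ z, φ z = (L * Q) i j := by
    intro i j
    rw [hLQ]
    change _ ∈ φ.range
    rcases i with i | i <;> rcases j with j | j
    · simp only [fromBlocks_apply₁₁, Matrix.smul_apply, smul_eq_mul]
      refine mul_mem (mul_mem (φ.mem_range_self v) (φ.mem_range_self g)) ?_
      rw [one_apply]
      split_ifs
      exacts [one_mem _, zero_mem _]
    · exact mul_mem (φ.mem_range_self u) (h2 i j)
    · exact mul_mem (φ.mem_range_self v) (h1 i j)
    · exact mul_mem (mul_mem (φ.mem_range_self u) (pow_mem (φ.mem_range_self y) _)) (h3 i j)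
  choose e' he' using hrange
  have hmap : (Matrix.of e').map φ = L * Q := by
    ext i j
    exact he' i j
  obtain ⟨s, A', B', h4, h5⟩ := hS.of_fintype (Matrix.of e') (by
    apply Matrix.map_injective hφ
    beta_reduce
    rw [Matrix.map_mul, hmap, Matrix.mul_assoc L, ← Matrix.mul_assoc Q, hQL, ← Matrix.mul_assoc,
      hLe])
  have h4' : A'.map φ * B'.map φ = L * Q := by rw [← Matrix.map_mul, h4, hmap]
  have h5' : B'.map φ * A'.map φ = 1 := by
    rw [← Matrix.map_mul, h5, Matrix.map_one _ (map_zero φ) (map_one φ)]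
  refine ⟨s, Q * A'.map φ, B'.map φ * L, ?_, ?_⟩
  · calc Q * A'.map φ * (B'.map φ * L) = Q * (A'.map φ * B'.map φ) * L := by
          simp only [Matrix.mul_assoc]
      _ = (Q * L) * (Q * L) := by rw [h4']; simp only [Matrix.mul_assoc]
      _ = e := by rw [hQL, he]
  · calc B'.map φ * L * (Q * A'.map φ) = B'.map φ * (L * Q) * A'.map φ := by
          simp only [Matrix.mul_assoc]
      _ = (B'.map φ * A'.map φ) * (B'.map φ * A'.map φ) := by
          rw [← h4']; simp only [Matrix.mul_assoc]
      _ = 1 := by rw [h5', Matrix.mul_one]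

end Splitting

/-! ### Clearing denominators and Laurent variables -/

section Denominators

open Matrix
open scoped Polynomial LaurentPolynomial

/-- If idempotents split over `Q ⊇ R`, and finitely many elements of `Q` have a common denominator
`d` satisfying `P`, then every idempotent over `R` splits up to a factor `d ^ 2`. -/
theorem IdempotentsSplit.exists_split_up_to {R Q : Type*} [CommRing R] [CommRing Q]
    (hQ : IdempotentsSplit Q) (φ : R →+* Q) (hφ : Function.Injective φ) (P : R → Prop)
    (hP : ∀ s : Finset Q, ∃ d, P d ∧ ∀ q ∈ s, φ d * q ∈ φ.range) {n : ℕ}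
    (e : Matrix (Fin n) (Fin n) R) (he : e * e = e) :
    ∃ (d : R) (r : ℕ) (A : Matrix (Fin n) (Fin r) R) (B : Matrix (Fin r) (Fin n) R), P d ∧
      A * B = d ^ 2 • e ∧ B * A = d ^ 2 • 1 ∧ e * A = A ∧ B * e = B := by
  classical
  obtain ⟨r, A, B, h1, h2⟩ := hQ n (e.map φ) (by rw [← Matrix.map_mul, he])
  obtain ⟨d, hd, hs⟩ := hP ((Finset.univ.image fun ij : Fin n × Fin r => A ij.1 ij.2) ∪
    Finset.univ.image fun ij : Fin r × Fin n => B ij.1 ij.2)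
  have hA : ∀ i j, ∃ z, φ z = φ d * A i j := fun i j => hs _ (Finset.mem_union_left _
    (Finset.mem_image.2 ⟨(i, j), Finset.mem_univ _, rfl⟩))
  have hB : ∀ i j, ∃ z, φ z = φ d * B i j := fun i j => hs _ (Finset.mem_union_right _
    (Finset.mem_image.2 ⟨(i, j), Finset.mem_univ _, rfl⟩))
  choose A' hA' using hA
  choose B' hB' using hB
  have mA : (Matrix.of A').map φ = φ d • A := by
    ext i j
    exact hA' i j
  have mB : (Matrix.of B').map φ = φ d • B := by
    ext i j
    exact hB' i j
  have hsm : ∀ {m l : ℕ} (c : R) (C : Matrix (Fin m) (Fin l) R), (c • C).map φ = φ c • C.map φ :=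
    fun c C => by
      ext i j
      simp
  refine ⟨d, r, Matrix.of A', Matrix.of B', hd, ?_, ?_, ?_, ?_⟩ <;>
    apply Matrix.map_injective hφ <;> beta_reduce <;> rw [Matrix.map_mul]
  · rw [mA, mB, hsm, Matrix.smul_mul, Matrix.mul_smul, h1, smul_smul, map_pow, sq]
  · rw [mA, mB, hsm, Matrix.smul_mul, Matrix.mul_smul, h2, smul_smul, map_pow, sq,
      Matrix.map_one _ (map_zero φ) (map_one φ)]
  · rw [mA, ← h1, Matrix.mul_smul, Matrix.mul_assoc, h2, Matrix.mul_one]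
  · rw [mB, ← h1, Matrix.smul_mul, ← Matrix.mul_assoc, h2, Matrix.one_mul]

/-- Finitely many elements of `(M⁻¹ D)[H]` have a common denominator in `M`. -/
theorem exists_common_denominator {D Q H : Type*} [CommRing D] [CommRing Q] [Algebra D Q]
    (M : Submonoid D) [IsLocalization M Q] [AddMonoid H] (s : Finset (AddMonoidAlgebra Q H)) :
    ∃ g ∈ M, ∀ q ∈ s, (AddMonoidAlgebra.single 0 (algebraMap D Q g) : AddMonoidAlgebra Q H) * q ∈
      (AddMonoidAlgebra.mapRingHom H (algebraMap D Q)).range := by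
  classical
  obtain ⟨b, hb⟩ := IsLocalization.exist_integer_multiples_of_finset M
    (s.biUnion fun q => q.coeff.support.image q.coeff)
  refine ⟨b, b.2, fun q hq => ?_⟩
  have h : ∀ h : H, ∃ d : D, algebraMap D Q d = algebraMap D Q b * q.coeff h ∧
      (q.coeff h = 0 → d = 0) := by
    intro h
    by_cases h0 : q.coeff h = 0
    · exact ⟨0, by simp [h0], fun _ => rfl⟩
    · obtain ⟨d, hd⟩ := hb (q.coeff h) (Finset.mem_biUnion.2 ⟨q, hq, Finset.mem_image.2
        ⟨h, Finsupp.mem_support_iff.2 h0, rfl⟩⟩)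
      exact ⟨d, by rw [hd, Algebra.smul_def], fun h => absurd h h0⟩
  choose d hd hd0 using h
  refine ⟨AddMonoidAlgebra.ofCoeff (Finsupp.onFinset q.coeff.support d fun h hh => ?_), ?_⟩
  · rw [Finsupp.mem_support_iff]
    exact fun h0 => hh (hd0 h h0)
  · ext h
    rw [AddMonoidAlgebra.coeff_single_zero_mul]
    simp [hd]

/-- Adjoining a Laurent variable. The field `k(y)` serves to make an idempotent over
`k[y, y⁻¹][H]` split after inverting a polynomial `g(y)` with `g(0) ≠ 0`. -/
theorem IdempotentsSplit.prod_int {H : Type*} [AddCommMonoid H]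
    (hH : ∀ (k : Type u) [Field k], IdempotentsSplit (AddMonoidAlgebra k H))
    (hN : ∀ (k : Type u) [Field k], IdempotentsSplit (AddMonoidAlgebra k (H × ℕ)))
    (k : Type u) [Field k] : IdempotentsSplit (AddMonoidAlgebra k (H × ℤ)) := by
  let Q := FractionRing k[X]
  have hX : ∀ y : Submonoid.powers (Polynomial.X : k[X]), IsUnit (algebraMap k[X] Q y) := by
    rintro ⟨_, m, rfl⟩
    exact (map_ne_zero_iff _ (IsFractionRing.injective k[X] Q)).2
      (pow_ne_zero m Polynomial.X_ne_zero) |>.isUnit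
  let ψ : k[T;T⁻¹] →+* Q := IsLocalization.lift hX
  have hψ : ∀ d : k[X], ψ (algebraMap k[X] k[T;T⁻¹] d) = algebraMap k[X] Q d :=
    IsLocalization.lift_eq hX
  have hXD : Submonoid.powers (Polynomial.X : k[X]) ≤ nonZeroDivisors k[X] :=
    powers_le_nonZeroDivisors_of_noZeroDivisors Polynomial.X_ne_zero
  have hDL : Function.Injective (algebraMap k[X] k[T;T⁻¹]) := IsLocalization.injective k[T;T⁻¹] hXD
  have hDQ : Function.Injective (algebraMap k[X] Q) := IsFractionRing.injective k[X] Q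
  have hψi : Function.Injective ψ := by
    rw [IsLocalization.lift_injective_iff]
    intro a b
    rw [hDL.eq_iff, hDQ.eq_iff]
  have hmap : ∀ {A B : Type u} [CommRing A] [CommRing B] (f : A →+* B), Function.Injective f →
      Function.Injective (AddMonoidAlgebra.mapRingHom H f) := by
    intro A B _ _ f hf a b hab
    ext h
    have := congrArg (fun x => x.coeff h) hab
    simp only [AddMonoidAlgebra.coeff_mapRingHom] at this
    exact hf this
  have hS : IdempotentsSplit (AddMonoidAlgebra k[X] H) :=
    (hN k).of_ringEquiv (AddMonoidAlgebra.curryRingEquiv.trans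
      (AddMonoidAlgebra.mapRingEquiv H (Polynomial.toFinsuppIso k).symm))
  suffices h : IdempotentsSplit (AddMonoidAlgebra k[T;T⁻¹] H) from
    h.of_ringEquiv AddMonoidAlgebra.curryRingEquiv.symm
  intro n e he
  let φ := AddMonoidAlgebra.mapRingHom H (algebraMap k[X] k[T;T⁻¹])
  let Ψ := AddMonoidAlgebra.mapRingHom H ψ
  have hsingle : ∀ (c : k[X]), φ (AddMonoidAlgebra.single 0 c) = AddMonoidAlgebra.single 0
    (algebraMap k[X] k[T;T⁻¹] c) := fun c => AddMonoidAlgebra.mapRingHom_single _ _ _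
  have hcomp : ∀ x, Ψ (φ x) = AddMonoidAlgebra.mapRingHom H (algebraMap k[X] Q) x := by
    intro x
    ext h
    simp only [Ψ, φ, AddMonoidAlgebra.coeff_mapRingHom, hψ]
  obtain ⟨_, r, A, B, ⟨g, hg, rfl⟩, hAB, hBA, heA, hBe⟩ := (hH Q).exists_split_up_to Ψ
    (hmap _ hψi) (fun d => ∃ g : k[X], g ≠ 0 ∧ d = φ (AddMonoidAlgebra.single 0 g)) (by
      intro s
      obtain ⟨g, hg, hs⟩ := exists_common_denominator (nonZeroDivisors k[X]) s
      refine ⟨_, ⟨g, nonZeroDivisors.ne_zero hg, rfl⟩, fun q hq => ?_⟩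
      obtain ⟨z, hz⟩ := hs q hq
      refine ⟨φ z, ?_⟩
      rw [hcomp, hcomp, hz, AddMonoidAlgebra.mapRingHom_single]) e he
  obtain ⟨a, g', hdvd, hg'⟩ := WfDvdMonoid.max_power_factor hg Polynomial.irreducible_X
  -- `T ^ (-2 a)` turns `g ^ 2` into a polynomial coprime to `X`
  let t : AddMonoidAlgebra k[T;T⁻¹] H := AddMonoidAlgebra.single 0 (LaurentPolynomial.T (-a))
  have ht : t * φ (AddMonoidAlgebra.single 0 g) = φ (AddMonoidAlgebra.single 0 g') := by
    rw [hsingle, hsingle, AddMonoidAlgebra.single_mul_single, add_zero, hg', map_mul, ← mul_assoc,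
      LaurentPolynomial.algebraMap_X_pow, ← LaurentPolynomial.T_add]
    simp
  have ht2 : t ^ 2 * φ (AddMonoidAlgebra.single 0 g) ^ 2 =
      φ (AddMonoidAlgebra.single 0 g' ^ 2) := by
    rw [← mul_pow, ht, map_pow]
  refine hS.exists_split_of_isCoprime φ (hmap _ hDL) (AddMonoidAlgebra.single 0 Polynomial.X) ?_
    e he A (t ^ 2 • B) (AddMonoidAlgebra.single 0 g' ^ 2) ?_ ?_ ?_ heA ?_
  · intro x
    obtain ⟨_, ⟨N, rfl⟩, hN⟩ :=
      exists_common_denominator (Submonoid.powers (Polynomial.X : k[X])) {x}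
    refine ⟨N, ?_⟩
    have := hN x (Finset.mem_singleton_self x)
    rwa [← hsingle, ← nsmul_zero N, ← AddMonoidAlgebra.single_pow, map_pow] at this
  · apply IsCoprime.pow_right
    have : IsCoprime (Polynomial.X : k[X]) g' :=
      (Irreducible.coprime_iff_not_dvd Polynomial.irreducible_X).2 hdvd
    exact this.map (AddMonoidAlgebra.singleZeroRingHom (R := k[X]) (M := H))
  · rw [Matrix.mul_smul, hAB, smul_smul, ht2]
  · rw [Matrix.smul_mul, hBA, smul_smul, ht2]
  · rw [Matrix.smul_mul, hBe]

/-- Projective modules over `k[ℕ^r × ℤ^s]` are free for all fields `k` as soon as this holds for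
`s = 0`. -/
theorem IdempotentsSplit.of_polynomial
    (h : ∀ (k : Type u) [Field k] (r : ℕ), IdempotentsSplit (MvPolynomial (Fin r) k)) (s : ℕ) :
    ∀ (k : Type u) [Field k] (r : ℕ),
      IdempotentsSplit (AddMonoidAlgebra k ((Fin r → ℕ) × (Fin s → ℤ))) := by
  induction s with
  | zero =>
    intro k _ r
    exact (h k r).of_ringEquiv (AddMonoidAlgebra.domCongr k k
      ((Finsupp.linearEquivFunOnFinite ℕ ℕ (Fin r)).toAddEquiv.trans
        AddEquiv.prodUnique.symm)).toRingEquiv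
  | succ s ih =>
    intro k _ r
    let e₁ : ((Fin (r + 1) → ℕ) × (Fin s → ℤ)) ≃+ ((Fin r → ℕ) × (Fin s → ℤ)) × ℕ :=
      (AddEquiv.prodCongr (Fin.consLinearEquiv ℕ fun _ : Fin (r + 1) => ℕ).symm.toAddEquiv
        (AddEquiv.refl _)).trans (AddEquiv.prodAssoc.trans AddEquiv.prodComm)
    let e₂ : ((Fin r → ℕ) × (Fin s → ℤ)) × ℤ ≃+ ((Fin r → ℕ) × (Fin (s + 1) → ℤ)) :=
      AddEquiv.prodAssoc.trans (AddEquiv.prodCongr (AddEquiv.refl _) (AddEquiv.prodComm.trans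
        (Fin.consLinearEquiv ℕ fun _ : Fin (s + 1) => ℤ).toAddEquiv))
    exact (IdempotentsSplit.prod_int (fun k _ => ih k r) (fun k _ => (ih k (r + 1)).of_ringEquiv
      (AddMonoidAlgebra.domCongr k k e₁).toRingEquiv) k).of_ringEquiv
      (AddMonoidAlgebra.domCongr k k e₂).toRingEquiv

end Denominators

/-! ### The perfected ring as a union -/

section Perfection

/-- The embedding `(a, b) ↦ p⁻ᵐ (a, b)` of `ℕ^r × ℤ^s` into the monoid of exponents. -/
def exponentsEmb (p : ℕ) [hp : Fact p.Prime] (r s m : ℕ) :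
    (Fin r → ℕ) × (Fin s → ℤ) →+ exponents p (r + s) r where
  toFun x := ⟨fun i =>
    (((Fin.append (fun j => (x.1 j : ℤ)) x.2 : Fin (r + s) → ℤ) i : ℤ) : ℚ) / p ^ m, fun i => by
    have hp0 : (p : ℚ) ≠ 0 := Nat.cast_ne_zero.2 hp.out.ne_zero
    refine ⟨⟨m, Fin.append (fun j => (x.1 j : ℤ)) x.2 i, by field_simp⟩, fun hi => ?_⟩
    obtain ⟨j, rfl⟩ : ∃ j, i = Fin.castAdd s j := ⟨⟨i, hi⟩, rfl⟩
    beta_reduce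
    rw [Fin.append_left]
    positivity⟩
  map_zero' := by
    ext i
    refine Fin.addCases (fun j => ?_) (fun j => ?_) i <;> simp
  map_add' x y := by
    ext i
    refine Fin.addCases (fun j => ?_) (fun j => ?_) i <;> simp [add_div]

theorem exponentsEmb_injective (p : ℕ) [hp : Fact p.Prime] (r s m : ℕ) :
    Function.Injective (exponentsEmb p r s m) := by
  intro x y h
  have hp0 : (p : ℚ) ≠ 0 := Nat.cast_ne_zero.2 hp.out.ne_zero
  have h' : ∀ i, (((Fin.append (fun j => (x.1 j : ℤ)) x.2 : Fin (r + s) → ℤ) i : ℤ) : ℚ) / p ^ m =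
    (((Fin.append (fun j => (y.1 j : ℤ)) y.2 : Fin (r + s) → ℤ) i : ℤ) : ℚ) / p ^ m :=
    fun i => congrFun (congrArg Subtype.val h) i
  refine Prod.ext (funext fun j => ?_) (funext fun j => ?_)
  · simpa [hp0, div_left_inj'] using h' (Fin.castAdd s j)
  · simpa [hp0, div_left_inj'] using h' (Fin.natAdd r j)

theorem mem_range_exponentsEmb (p : ℕ) [hp : Fact p.Prime] (r s m : ℕ)
    (α : exponents p (r + s) r) (h : ∀ i, ∃ z : ℤ, (p : ℚ) ^ m * α.1 i = z) :
    α ∈ Set.range (exponentsEmb p r s m) := by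
  have hp0 : (0 : ℚ) < p := Nat.cast_pos.2 hp.out.pos
  choose z hz using h
  have hpos : ∀ j : Fin r, 0 ≤ z (Fin.castAdd s j) := by
    intro j
    have h1 := (α.2 (Fin.castAdd s j)).2 j.2
    have h2 := mul_nonneg (pow_pos hp0 m).le h1
    rw [hz] at h2
    exact_mod_cast h2
  refine ⟨(fun j => (z (Fin.castAdd s j)).toNat, fun j => z (Fin.natAdd r j)), ?_⟩
  ext i
  change (((Fin.append _ _ : Fin (r + s) → ℤ) i : ℤ) : ℚ) / p ^ m = α.1 i
  rw [div_eq_iff (pow_pos hp0 m).ne', mul_comm, hz]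
  refine Fin.addCases (fun j => ?_) (fun j => ?_) i
  · rw [Fin.append_left, Int.toNat_of_nonneg (hpos j)]
  · rw [Fin.append_right]

theorem exists_common_exponent (p r s : ℕ) (t : Finset (exponents p (r + s) r)) :
    ∃ m : ℕ, ∀ α ∈ t, ∀ i, ∃ z : ℤ, (p : ℚ) ^ m * α.1 i = z := by
  choose N hN using fun (α : exponents p (r + s) r) i => (α.2 i).1
  refine ⟨∑ α ∈ t, ∑ i, N α i, fun α hα i => ?_⟩
  have hle : N α i ≤ ∑ α ∈ t, ∑ i, N α i :=
    (Finset.single_le_sum (f := N α) (fun _ _ => Nat.zero_le _) (Finset.mem_univ i)).trans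
      (Finset.single_le_sum (f := fun α => ∑ i, N α i) (fun _ _ => Nat.zero_le _) hα)
  obtain ⟨z, hz⟩ := hN α i
  refine ⟨p ^ (∑ α ∈ t, ∑ i, N α i - N α i) * z, ?_⟩
  push_cast
  rw [← hz, ← mul_assoc, ← pow_add, Nat.sub_add_cancel hle]

theorem IdempotentsSplit.perfLaurent (k : Type u) [Field k] (p : ℕ) [Fact p.Prime] (r s : ℕ)
    (h : IdempotentsSplit (AddMonoidAlgebra k ((Fin r → ℕ) × (Fin s → ℤ)))) :
    IdempotentsSplit (PerfLaurent k p (r + s) r) := by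
  classical
  refine IdempotentsSplit.of_finite_subsets fun S => ?_
  obtain ⟨m, hm⟩ := exists_common_exponent p r s (S.biUnion fun x => x.coeff.support)
  refine ⟨_, _, AddMonoidAlgebra.mapDomainRingHom k (exponentsEmb p r s m),
    AddMonoidAlgebra.mapDomain_injective (exponentsEmb_injective p r s m), h, fun x hx => ?_⟩
  rw [← AddMonoidAlgebra.sum_coeff_single x]
  refine sum_mem fun α hα => ?_
  obtain ⟨a, rfl⟩ := mem_range_exponentsEmb p r s m α
    (hm α (Finset.mem_biUnion.2 ⟨x, hx, hα⟩))
  exact ⟨AddMonoidAlgebra.single a (x.coeff _), AddMonoidAlgebra.mapDomain_single⟩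

end Perfection

/-! ### Unimodular vectors -/

section Vectors

open Matrix
open scoped Polynomial

section Unimodular

variable {ι : Type*} [Fintype ι] {R S : Type*} [CommRing R] [CommRing S]

/-- A vector whose entries generate the unit ideal. -/
def IsUnimodular (f : ι → R) : Prop := ∃ w : ι → R, w ⬝ᵥ f = 1

theorem IsUnimodular.map {f : ι → R} (h : IsUnimodular f) (φ : R →+* S) :
    IsUnimodular (fun i => φ (f i)) := by
  obtain ⟨w, hw⟩ := h
  refine ⟨fun i => φ (w i), ?_⟩
  have := congrArg φ hw
  rwa [map_one, RingHom.map_dotProduct] at this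

variable [DecidableEq ι]

/-- Two vectors are equivalent if an invertible matrix carries one to the other. -/
def VecEquiv (f g : ι → R) : Prop := ∃ M : (Matrix ι ι R)ˣ, (M : Matrix ι ι R) *ᵥ f = g

theorem VecEquiv.refl (f : ι → R) : VecEquiv f f := ⟨1, by simp⟩

theorem VecEquiv.trans {f g h : ι → R} (h₁ : VecEquiv f g) (h₂ : VecEquiv g h) : VecEquiv f h := by
  obtain ⟨M, rfl⟩ := h₁
  obtain ⟨N, rfl⟩ := h₂
  exact ⟨N * M, by simp [mulVec_mulVec]⟩

theorem VecEquiv.map {f g : ι → R} (h : VecEquiv f g) (φ : R →+* S) :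
    VecEquiv (fun i => φ (f i)) (fun i => φ (g i)) := by
  obtain ⟨M, rfl⟩ := h
  refine ⟨Units.map φ.mapMatrix.toMonoidHom M, ?_⟩
  ext i
  exact (RingHom.map_mulVec φ _ _ _).symm

theorem IsUnimodular.of_vecEquiv {f g : ι → R} (hf : IsUnimodular f) (h : VecEquiv f g) :
    IsUnimodular g := by
  obtain ⟨M, rfl⟩ := h
  obtain ⟨w, hw⟩ := hf
  refine ⟨w ᵥ* (↑M⁻¹ : Matrix ι ι R), ?_⟩
  rw [dotProduct_mulVec, vecMul_vecMul, Units.inv_mul, vecMul_one, hw]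

/-- Adding multiples of the `i`-th entry to the other entries. -/
theorem VecEquiv.add_mul (f : ι → R) (i : ι) (q : ι → R) (hq : q i = 0) :
    VecEquiv f (fun j => f j + q j * f i) := by
  have h : vecMulVec q (Pi.single i (1 : R)) * vecMulVec q (Pi.single i 1) = 0 := by
    rw [vecMulVec_mul_vecMulVec]
    simp [hq]
  refine ⟨⟨1 + vecMulVec q (Pi.single i 1), 1 - vecMulVec q (Pi.single i 1), ?_, ?_⟩, ?_⟩
  · rw [mul_sub, _root_.add_mul, _root_.add_mul, h]
    simp
  · rw [mul_add, sub_mul, sub_mul, h]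
    simp
  · ext j
    simp [add_mulVec, vecMulVec_mulVec, mul_comm]

theorem VecEquiv.smul (f : ι → R) (u : Rˣ) : VecEquiv f (u.1 • f) :=
  ⟨Units.map (Matrix.scalar ι).toMonoidHom u, by
    ext j
    simp [Matrix.scalar_apply, mulVec_diagonal]⟩

theorem VecEquiv.single_of_isUnit {f : ι → R} {i : ι} (h : IsUnit (f i)) :
    VecEquiv f (Pi.single i 1) := by
  obtain ⟨u, hu⟩ := h
  refine (VecEquiv.smul f u⁻¹).trans ?_
  have h1 : (u⁻¹.1 • f) i = 1 := by simp [← hu]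
  refine (VecEquiv.add_mul _ i (fun j => if j = i then 0 else -(u⁻¹.1 • f) j) (by simp)).trans ?_
  have h2 : (fun j => (u⁻¹.1 • f) j + (if j = i then 0 else -(u⁻¹.1 • f) j) * (u⁻¹.1 • f) i) =
      Pi.single i 1 := ?_
  · rw [h2]
    exact VecEquiv.refl _
  ext j
  rw [h1]
  by_cases hj : j = i
  · subst hj
    simp [h1]
  · simp [hj]

theorem VecEquiv.single_single (i j : ι) :
    VecEquiv (Pi.single i (1 : R)) (Pi.single j 1) := by
  by_cases hij : i = j
  · rw [hij]
    exact VecEquiv.refl _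
  · refine (VecEquiv.add_mul _ i (Pi.single j 1) (by simp [hij])).trans
      (VecEquiv.single_of_isUnit ?_)
    simp [Ne.symm hij]

theorem VecEquiv.single_two {f : Fin 2 → R} (h : IsUnimodular f) :
    VecEquiv f (Pi.single 0 1) := by
  obtain ⟨w, hw⟩ := h
  rw [dotProduct, Fin.sum_univ_two] at hw
  refine ⟨⟨!![w 0, w 1; -f 1, f 0], !![f 0, -w 1; f 1, w 0], ?_, ?_⟩, ?_⟩
  · ext i j
    fin_cases i <;> fin_cases j <;> simp <;> first | ring1 | linear_combination hw
  · ext i j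
    fin_cases i <;> fin_cases j <;> simp <;> first | ring1 | linear_combination hw
  · ext i
    fin_cases i
    · simpa [mulVec, dotProduct] using hw
    · simp [mulVec, dotProduct]
      ring

end Unimodular

/-! ### Vectors over `A[X]` with a monic entry, for a local ring `A` -/

/-- Let `f` be monic of degree `d`, and `g` of smaller degree with some coefficient a unit. Then
the ideal `(f, g)` contains a monic polynomial of degree `d - 1`: the coefficients of `X ^ (d - 1)`
in the elements of `(f, g)` of degree less than `d` form an ideal, and multiplying by `X` and
reducing modulo `f` shows that it contains all coefficients of `g`. -/
theorem exists_monic_mem_span_pair {A : Type*} [CommRing A] {f g : A[X]} {d : ℕ} (hf : f.Monic)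
    (hd : f.natDegree = d + 1) (hg : g.degree < d + 1) {k : ℕ} (hk : IsUnit (g.coeff k)) :
    ∃ a b : A[X], (a * f + b * g).coeff d = 1 ∧ (a * f + b * g).degree < d + 1 := by
  let I : Submodule A A[X] := (Ideal.span {f, g}).restrictScalars A ⊓ Polynomial.degreeLT A (d + 1)
  let J : Ideal A := I.map (Polynomial.lcoeff A d)
  have hfd : f.degree = d + 1 := by
    rcases subsingleton_or_nontrivial A with h | h
    · exact absurd hg (by simp [Subsingleton.elim f 0] at hd)
    · rw [Polynomial.degree_eq_natDegree hf.ne_zero, hd]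
      rfl
  have key : ∀ m, m ≤ d → ∀ q ∈ I, q.coeff (d - m) ∈ J := by
    intro m
    induction m with
    | zero => exact fun _ q hq => ⟨q, hq, rfl⟩
    | succ m ih =>
      intro hm q hq
      have hq2 : q.degree < d + 1 := by
        have := hq.2
        rw [SetLike.mem_coe, Polynomial.mem_degreeLT] at this
        exact_mod_cast this
      have hq' : Polynomial.X * q - Polynomial.C (q.coeff d) * f ∈ I := by
        refine ⟨sub_mem (Ideal.mul_mem_left _ _ hq.1)
          (Ideal.mul_mem_left _ _ (Ideal.subset_span (by simp))), ?_⟩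
        rw [SetLike.mem_coe, Polynomial.mem_degreeLT, Polynomial.degree_lt_iff_coeff_zero]
        intro N hN
        rcases hN.eq_or_lt with rfl | hN
        · have : f.coeff (d + 1) = 1 := by rw [← hd]; exact hf
          simp [Polynomial.coeff_X_mul, this]
        · obtain ⟨N, rfl⟩ := Nat.exists_eq_add_of_lt hN
          have h1 : f.coeff (d + 1 + N + 1) = 0 :=
            Polynomial.coeff_eq_zero_of_natDegree_lt (by omega)
          have h2 : q.coeff (d + 1 + N) = 0 :=
            Polynomial.coeff_eq_zero_of_degree_lt (hq2.trans_le (by norm_cast; omega))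
          rw [Polynomial.coeff_sub, Polynomial.coeff_X_mul, Polynomial.coeff_C_mul, h1, h2]
          simp
      have h3 := ih (by omega) _ hq'
      rw [show d - m = d - (m + 1) + 1 by omega, Polynomial.coeff_sub, Polynomial.coeff_X_mul,
        Polynomial.coeff_C_mul] at h3
      have h4 : q.coeff d * f.coeff (d - (m + 1) + 1) ∈ J :=
        J.mul_mem_right _ ⟨q, hq, rfl⟩
      simpa using add_mem h3 h4
  have hgI : g ∈ I := by
    refine ⟨Ideal.subset_span (by simp), ?_⟩
    rw [SetLike.mem_coe, Polynomial.mem_degreeLT]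
    exact_mod_cast hg
  have h1 : (1 : A) ∈ J := by
    by_cases hkd : k ≤ d
    · have := key (d - k) (by omega) g hgI
      rw [Nat.sub_sub_self hkd] at this
      exact (Ideal.eq_top_iff_one J).1 (Ideal.eq_top_of_isUnit_mem _ this hk)
    · have h0 : g.coeff k = 0 :=
        Polynomial.coeff_eq_zero_of_degree_lt (hg.trans_le (by norm_cast; omega))
      rw [h0, isUnit_zero_iff] at hk
      rw [← hk]
      exact zero_mem _
  obtain ⟨q, hq, hq1⟩ := h1
  obtain ⟨a, b, rfl⟩ := Ideal.mem_span_pair.1 hq.1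
  refine ⟨a, b, hq1, ?_⟩
  have := hq.2
  rw [SetLike.mem_coe, Polynomial.mem_degreeLT] at this
  exact_mod_cast this

/-- **Horrocks' theorem** for unimodular vectors, by induction on the degree of a monic entry: the
remaining entries are reduced modulo it, one of them then has a unit coefficient, and
`exists_monic_mem_span_pair` makes a third one monic of smaller degree. -/
theorem VecEquiv.single_of_monic {A : Type*} [CommRing A] [IsLocalRing A] {ι : Type*} [Fintype ι]
    [DecidableEq ι] (hι : ∀ i j : ι, ∃ l, l ≠ i ∧ l ≠ j) (d : ℕ) :
    ∀ (f : ι → A[X]) (i : ι), (f i).Monic → (f i).natDegree = d → IsUnimodular f →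
      VecEquiv f (Pi.single i 1) := by
  induction d with
  | zero =>
    intro f i hm hd _
    apply VecEquiv.single_of_isUnit
    rw [hm.natDegree_eq_zero.1 hd]
    exact isUnit_one
  | succ d ih =>
    intro f i hm hd hu
    let f₁ : ι → A[X] := fun j => f j + (if j = i then 0 else -(f j /ₘ f i)) * f i
    have e₁ : VecEquiv f f₁ := VecEquiv.add_mul f i _ (by simp)
    have hfi : f₁ i = f i := by simp [f₁]
    have hfd : (f i).degree = d + 1 := by
      rw [Polynomial.degree_eq_natDegree hm.ne_zero, hd]
      rfl
    have hfj : ∀ j, j ≠ i → (f₁ j).degree < d + 1 := by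
      intro j hj
      have : f₁ j = f j %ₘ f i := by
        simp only [f₁, hj, if_false]
        rw [Polynomial.modByMonic_eq_sub_mul_div]
        ring
      rw [this, ← hfd]
      exact Polynomial.degree_modByMonic_lt _ hm
    have hu₁ := hu.of_vecEquiv e₁
    refine e₁.trans ?_
    obtain ⟨j, hji, k, hk⟩ : ∃ j, j ≠ i ∧ ∃ k, IsUnit ((f₁ j).coeff k) := by
      by_contra! hcon
      -- modulo the maximal ideal only the monic entry survives, so it would be a unit
      let ρ := Polynomial.mapRingHom (IsLocalRing.residue A)
      obtain ⟨w, hw⟩ := hu₁.map ρ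
      have h0 : ∀ j, j ≠ i → ρ (f₁ j) = 0 := by
        intro j hj
        ext k
        rw [Polynomial.coe_mapRingHom, Polynomial.coeff_map, Polynomial.coeff_zero,
          IsLocalRing.residue_eq_zero_iff]
        exact hcon j hj k
      rw [dotProduct, Finset.sum_eq_single i (fun j _ hj => by simp [h0 j hj]) (by simp), hfi] at hw
      have hun : IsUnit (ρ (f i)) := IsUnit.of_mul_eq_one_right _ hw
      have := (hm.map (IsLocalRing.residue A)).eq_one_of_isUnit hun
      have h2 := hm.natDegree_map (IsLocalRing.residue A)
      rw [this, hd, Polynomial.natDegree_one] at h2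
      omega
    obtain ⟨l, hli, hlj⟩ := hι i j
    obtain ⟨a, b, hab, habd⟩ := exists_monic_mem_span_pair (hfi ▸ hm) (hfi ▸ hd) (hfj j hji) hk
    let c := Polynomial.C (1 - (f₁ l).coeff d)
    let f₂ : ι → A[X] := fun t => f₁ t + (if t = l then c * a else 0) * f₁ i
    let f₃ : ι → A[X] := fun t => f₂ t + (if t = l then c * b else 0) * f₂ j
    have e₂ : VecEquiv f₁ f₂ := VecEquiv.add_mul f₁ i _ (by simp [hli.symm])
    have e₃ : VecEquiv f₂ f₃ := VecEquiv.add_mul f₂ j _ (by simp [hlj.symm])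
    have hf₃ : f₃ l = f₁ l + c * (a * f₁ i + b * f₁ j) := by
      simp only [f₃, f₂, if_true, hlj.symm, if_false]
      ring
    have hcoeff : (f₃ l).coeff d = 1 := by
      rw [hf₃, Polynomial.coeff_add, Polynomial.coeff_C_mul, hab]
      ring
    have hdeg : (f₃ l).degree < d + 1 := by
      rw [hf₃]
      refine (Polynomial.degree_add_le _ _).trans_lt (max_lt (hfj l hli) ?_)
      rw [← Polynomial.smul_eq_C_mul]
      exact (Polynomial.degree_smul_le _ _).trans_lt habd
    have hnat : (f₃ l).natDegree = d := by
      apply le_antisymm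
      · rw [Polynomial.natDegree_le_iff_coeff_eq_zero]
        intro N hN
        exact Polynomial.coeff_eq_zero_of_degree_lt (hdeg.trans_le (by norm_cast))
      · exact Polynomial.le_natDegree_of_ne_zero (by rw [hcoeff]; exact one_ne_zero)
    have hmon : (f₃ l).Monic := by rw [Polynomial.Monic, Polynomial.leadingCoeff, hnat, hcoeff]
    exact (e₂.trans e₃).trans ((ih f₃ l hmon hnat (hu₁.of_vecEquiv (e₂.trans e₃))).trans
      (VecEquiv.single_single l i))

end Vectors

/-! ### Patching unimodular vectors -/

section Patching

open Matrix
open scoped Polynomial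

/-- Elements of `L[X][Y]`, for a localization `L` of `A` at `M`, whose constant terms in `Y` are
integral become integral after substituting `c Y` for `Y`, for a suitable `c ∈ M`. -/
theorem exists_comp_mem_range {A L : Type*} [CommRing A] [CommRing L] [Algebra A L]
    (M : Submonoid A) [IsLocalization M L] (s : Finset L[X][X])
    (hs : ∀ h ∈ s, h.coeff 0 ∈ (Polynomial.mapRingHom (algebraMap A L)).range) :
    ∃ c ∈ M, ∀ h ∈ s,
      h.comp (Polynomial.C (Polynomial.C (algebraMap A L c)) * Polynomial.X) ∈
        (Polynomial.mapRingHom (Polynomial.mapRingHom (algebraMap A L))).range := by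
  classical
  obtain ⟨b, hb⟩ := IsLocalization.exist_integer_multiples_of_finset M
    (s.biUnion fun h => h.support.biUnion fun k => (h.coeff k).support.image (h.coeff k).coeff)
  refine ⟨b, b.2, fun h hh => ?_⟩
  rw [Polynomial.mem_map_range]
  intro k
  rw [Polynomial.comp_C_mul_X_coeff]
  rcases k with _ | k
  · simpa using hs h hh
  rw [Polynomial.mem_map_range]
  intro l
  rw [← Polynomial.C_pow, Polynomial.coeff_mul_C, pow_succ', ← mul_assoc]
  refine mul_mem ?_ (pow_mem ((algebraMap A L).mem_range_self _) _)
  by_cases h0 : (h.coeff (k + 1)).coeff l = 0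
  · rw [h0, zero_mul]
    exact zero_mem _
  · have hk : h.coeff (k + 1) ≠ 0 := fun h' => h0 (by rw [h', Polynomial.coeff_zero])
    obtain ⟨z, hz⟩ := hb _ (Finset.mem_biUnion.2 ⟨h, hh, Finset.mem_biUnion.2
      ⟨k + 1, Polynomial.mem_support_iff.2 hk,
        Finset.mem_image_of_mem _ (Polynomial.mem_support_iff.2 h0)⟩⟩)
    exact ⟨z, by rw [hz, Algebra.smul_def, mul_comm]⟩

variable {A : Type u} [CommRing A] {ι : Type*} [Fintype ι] [DecidableEq ι]

/-- The elements `c` of `A` such that `f(a + c b)` and `f(a)` are equivalent for all `a`, `b` in all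
`A`-algebras. -/
def patchingIdeal (f : ι → A[X]) : Ideal A where
  carrier := {c | ∀ (B : Type u) [CommRing B] [Algebra A B] (a b : B),
    VecEquiv (fun j => Polynomial.aeval (a + c • b) (f j)) (fun j => Polynomial.aeval a (f j))}
  zero_mem' := fun B _ _ a b => by simpa using VecEquiv.refl _
  add_mem' := by
    intro c c' hc hc' B _ _ a b
    refine VecEquiv.trans ?_ (hc B a b)
    simpa [add_smul, add_assoc] using hc' B (a + c • b) b
  smul_mem' := by
    intro d c hc B _ _ a b
    simpa [smul_smul, mul_comm] using hc B a (d • b)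

/-- If `f` becomes equivalent to a basis vector over `L[X]`, for a localization `L` of `A` at `M`,
then the patching ideal meets `M`: over `L[X, Y]` there is a matrix carrying `f(X + Y)` to `f(X)`
which is the identity for `Y = 0`, and substituting a multiple of `Y` clears its denominators. -/
theorem exists_mem_patchingIdeal_of_localization [IsDomain A] (f : ι → A[X]) (M : Submonoid A)
    (hM : M ≤ nonZeroDivisors A) {L : Type u} [CommRing L] [Algebra A L] [IsLocalization M L]
    (i : ι) (h : VecEquiv (fun j => Polynomial.map (algebraMap A L) (f j)) (Pi.single i 1)) :
    ∃ c ∈ M, c ∈ patchingIdeal f := by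
  classical
  obtain ⟨⟨U, V, hUV, hVU⟩, hU⟩ := h
  change U *ᵥ _ = _ at hU
  have hV : V *ᵥ Pi.single i 1 = fun j => Polynomial.map (algebraMap A L) (f j) := by
    rw [← hU, mulVec_mulVec, hVU, one_mulVec]
  let τ₀ : L[X] →+* L[X][X] := Polynomial.C
  let τ₁ : L[X] →+* L[X][X] := Polynomial.eval₂RingHom (Polynomial.C.comp Polynomial.C)
    (Polynomial.C Polynomial.X + Polynomial.X)
  have hmm : ∀ {B C : Type u} [CommRing B] [CommRing C] (φ : B →+* C) (P Q : Matrix ι ι B),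
      P * Q = 1 → P.map φ * Q.map φ = 1 := by
    intro B C _ _ φ P Q h
    rw [← Matrix.map_mul, h, Matrix.map_one _ (map_zero φ) (map_one φ)]
  -- `G = V(X) U(X + Y)` carries `f(X + Y)` to `f(X)` and is the identity for `Y = 0`
  let G : Matrix ι ι L[X][X] := V.map τ₀ * U.map τ₁
  let H : Matrix ι ι L[X][X] := V.map τ₁ * U.map τ₀
  have hGH : G * H = 1 := by
    simp only [G, H]
    rw [Matrix.mul_assoc, ← Matrix.mul_assoc (U.map τ₁), hmm τ₁ U V hUV, Matrix.one_mul,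
      hmm τ₀ V U hVU]
  have hHG : H * G = 1 := by
    simp only [G, H]
    rw [Matrix.mul_assoc, ← Matrix.mul_assoc (U.map τ₀), hmm τ₀ U V hUV, Matrix.one_mul,
      hmm τ₁ V U hVU]
  have hGf : G *ᵥ (fun j => τ₁ (Polynomial.map (algebraMap A L) (f j))) =
      fun j => τ₀ (Polynomial.map (algebraMap A L) (f j)) := by
    have h₁ : U.map τ₁ *ᵥ (fun j => τ₁ (Polynomial.map (algebraMap A L) (f j))) =
        Pi.single i 1 := by
      ext1 j
      have := (RingHom.map_mulVec τ₁ U (fun j => Polynomial.map (algebraMap A L) (f j)) j).symm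
      rw [hU] at this
      refine this.trans ?_
      rw [Pi.single_apply, Pi.single_apply, apply_ite τ₁, map_one, map_zero]
    have h₀ : V.map τ₀ *ᵥ Pi.single i 1 =
        fun j => τ₀ (Polynomial.map (algebraMap A L) (f j)) := by
      ext1 j
      have := (RingHom.map_mulVec τ₀ V (Pi.single i 1) j).symm
      rw [hV] at this
      refine Eq.trans ?_ this
      congr 2
      ext1 l
      simp only [Function.comp_apply]
      rw [Pi.single_apply, Pi.single_apply, apply_ite τ₀, map_one, map_zero]
    rw [← mulVec_mulVec, h₁, h₀]
  let ev : L[X][X] →+* L[X] := Polynomial.evalRingHom 0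
  have hev₀ : ∀ P : Matrix ι ι L[X], (P.map τ₀).map ev = P := by
    intro P
    ext1 j k
    simp [ev, τ₀]
  have hev₁ : ∀ P : Matrix ι ι L[X], (P.map τ₁).map ev = P := by
    intro P
    have : ev.comp τ₁ = RingHom.id _ := by ext <;> simp [ev, τ₁]
    ext1 j k
    exact RingHom.congr_fun this _
  have hone : ∀ P : Matrix ι ι L[X][X], P.map ev = 1 → ∀ j k,
      (P j k).coeff 0 ∈ (Polynomial.mapRingHom (algebraMap A L)).range := by
    intro P hP j k
    have : ev (P j k) = (1 : Matrix ι ι L[X]) j k := congrFun (congrFun hP j) k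
    rw [Polynomial.coeff_zero_eq_eval_zero]
    change ev (P j k) ∈ _
    rw [this, Matrix.one_apply]
    split_ifs
    exacts [one_mem _, zero_mem _]
  have hG0 := hone G (by rw [Matrix.map_mul, hev₀, hev₁, hVU])
  have hH0 := hone H (by rw [Matrix.map_mul, hev₀, hev₁, hVU])
  obtain ⟨c, hc, hs⟩ := exists_comp_mem_range M
    ((Finset.univ.image fun jk : ι × ι => G jk.1 jk.2) ∪
      Finset.univ.image fun jk : ι × ι => H jk.1 jk.2) (by
    intro h hh
    rcases Finset.mem_union.1 hh with hh | hh <;>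
      obtain ⟨jk, -, rfl⟩ := Finset.mem_image.1 hh
    exacts [hG0 _ _, hH0 _ _])
  let Φ := Polynomial.mapRingHom (Polynomial.mapRingHom (algebraMap A L))
  have hΦ : Function.Injective Φ := Polynomial.map_injective _
    (Polynomial.map_injective _ (IsLocalization.injective L hM))
  let σ := Polynomial.compRingHom
    (Polynomial.C (Polynomial.C (algebraMap A L c)) * Polynomial.X : L[X][X])
  have hG' : ∀ j k, ∃ z, Φ z = σ (G j k) := fun j k => hs _ (Finset.mem_union_left _
    (Finset.mem_image.2 ⟨(j, k), Finset.mem_univ _, rfl⟩))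
  have hH' : ∀ j k, ∃ z, Φ z = σ (H j k) := fun j k => hs _ (Finset.mem_union_right _
    (Finset.mem_image.2 ⟨(j, k), Finset.mem_univ _, rfl⟩))
  choose G' hG' using hG'
  choose H' hH' using hH'
  have mG : (Matrix.of G').map Φ = G.map σ := by
    ext1 j k
    exact hG' j k
  have mH : (Matrix.of H').map Φ = H.map σ := by
    ext1 j k
    exact hH' j k
  have key : VecEquiv
      (fun j => Polynomial.aeval (Polynomial.C Polynomial.X + c • Polynomial.X : A[X][X]) (f j))
      (fun j => Polynomial.aeval (Polynomial.C Polynomial.X : A[X][X]) (f j)) := by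
    refine ⟨⟨Matrix.of G', Matrix.of H', Matrix.map_injective hΦ ?_,
      Matrix.map_injective hΦ ?_⟩, ?_⟩
    · beta_reduce
      rw [Matrix.map_mul, mG, mH, hmm σ G H hGH, Matrix.map_one _ (map_zero Φ) (map_one Φ)]
    · beta_reduce
      rw [Matrix.map_mul, mG, mH, hmm σ H G hHG, Matrix.map_one _ (map_zero Φ) (map_one Φ)]
    · ext1 j
      apply hΦ
      have e₁ : ∀ p : A[X],
          Φ (Polynomial.aeval (Polynomial.C Polynomial.X + c • Polynomial.X : A[X][X]) p) =
            σ (τ₁ (Polynomial.map (algebraMap A L) p)) := by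
        intro p
        change ((Φ.comp (Polynomial.aeval (Polynomial.C Polynomial.X + c • Polynomial.X :
          A[X][X])).toRingHom) p) =
            ((σ.comp τ₁).comp (Polynomial.mapRingHom (algebraMap A L))) p
        congr 1
        ext <;> simp [Φ, σ, τ₁, Algebra.smul_def, Polynomial.algebraMap_apply]
      have e₀ : ∀ p : A[X], Φ (Polynomial.aeval (Polynomial.C Polynomial.X : A[X][X]) p) =
            σ (τ₀ (Polynomial.map (algebraMap A L) p)) := by
        intro p
        change ((Φ.comp (Polynomial.aeval (Polynomial.C Polynomial.X : A[X][X])).toRingHom) p) =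
            ((σ.comp τ₀).comp (Polynomial.mapRingHom (algebraMap A L))) p
        congr 1
        ext <;> simp [Φ, σ, τ₀, Polynomial.algebraMap_apply]
      rw [e₀]
      refine (RingHom.map_mulVec Φ _ _ _).trans ?_
      change ((Matrix.of G').map Φ *ᵥ fun j => _) j = _
      rw [mG]
      simp only [Function.comp_apply, e₁]
      refine (RingHom.map_mulVec σ G _ j).symm.trans ?_
      rw [hGf]
  refine ⟨c, hc, fun B _ _ a b => ?_⟩
  have := key.map (Polynomial.eval₂RingHom (Polynomial.aeval a : A[X] →ₐ[A] B).toRingHom b)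
  convert this using 2 with j j
  · have : ∀ p : A[X], Polynomial.aeval (a + c • b) p =
        ((Polynomial.eval₂RingHom (Polynomial.aeval a : A[X] →ₐ[A] B).toRingHom b).comp
          (Polynomial.aeval (Polynomial.C Polynomial.X + c • Polynomial.X : A[X][X])).toRingHom)
            p := by
      intro p
      change (Polynomial.aeval (a + c • b) : A[X] →ₐ[A] B).toRingHom p = _
      congr 1
      ext <;> simp [Algebra.smul_def, Polynomial.algebraMap_apply]
    exact this _
  · have : ∀ p : A[X], Polynomial.aeval a p =
        ((Polynomial.eval₂RingHom (Polynomial.aeval a : A[X] →ₐ[A] B).toRingHom b).comp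
          (Polynomial.aeval (Polynomial.C Polynomial.X : A[X][X])).toRingHom) p := by
      intro p
      change (Polynomial.aeval a : A[X] →ₐ[A] B).toRingHom p = _
      congr 1
      ext <;> simp [Polynomial.algebraMap_apply]
    exact this _

/-- A unimodular vector over `A[X]` with a monic entry is equivalent to its value at `0`. By
Horrocks' theorem the patching ideal lies in no maximal ideal, so it contains `1`, and `f(0 + X)`
is equivalent to `f(0)`. -/
theorem VecEquiv.eval_zero_of_monic [IsDomain A] (hι : ∀ i j : ι, ∃ l, l ≠ i ∧ l ≠ j)
    (f : ι → A[X]) (hf : IsUnimodular f) (i : ι) (hi : (f i).Monic) :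
    VecEquiv f (fun j => Polynomial.C ((f j).eval 0)) := by
  have htop : patchingIdeal f = ⊤ := by
    by_contra hne
    obtain ⟨m, hm, hle⟩ := Ideal.exists_le_maximal _ hne
    have := hm.isPrime
    let L := Localization.AtPrime m
    obtain ⟨c, hc, hcI⟩ := exists_mem_patchingIdeal_of_localization f m.primeCompl
      m.primeCompl_le_nonZeroDivisors (L := L) i
      (VecEquiv.single_of_monic hι _ _ i (hi.map _) rfl
        (hf.map (Polynomial.mapRingHom (algebraMap A L))))
    exact hc (hle hcI)
  have h1 : (1 : A) ∈ patchingIdeal f := htop ▸ Submodule.mem_top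
  have := h1 A[X] 0 Polynomial.X
  simpa [Polynomial.aeval_def, Polynomial.eval₂_at_zero, Polynomial.coeff_zero_eq_eval_zero]
    using this

end Patching

/-! ### Schanuel's lemma and characteristic resolutions over `A[X]` -/

section Resolutions

open Matrix
open scoped Polynomial

section Schanuel

variable {R M N P : Type*} [Ring R] [AddCommGroup M] [AddCommGroup N] [AddCommGroup P] [Module R M]
  [Module R N] [Module R P]

/-- **Schanuel's lemma.** -/
theorem nonempty_schanuel_equiv [Module.Projective R M] [Module.Projective R N] (f : M →ₗ[R] P)
    (g : N →ₗ[R] P) (hf : Function.Surjective f) (hg : Function.Surjective g) :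
    Nonempty ((LinearMap.ker f × N) ≃ₗ[R] (LinearMap.ker g × M)) := by
  obtain ⟨h, hh⟩ := Module.projective_lifting_property g f hg
  obtain ⟨k, hk⟩ := Module.projective_lifting_property f g hf
  replace hh : ∀ x, g (h x) = f x := fun x => LinearMap.congr_fun hh x
  replace hk : ∀ x, f (k x) = g x := fun x => LinearMap.congr_fun hk x
  refine ⟨{
    toFun := fun x => (⟨x.2 - h (x.1 + k x.2), by
      have := LinearMap.mem_ker.1 x.1.2
      simp [hh, hk, this]⟩, x.1 + k x.2)
    invFun := fun y => (⟨y.2 - k (y.1 + h y.2), by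
      have := LinearMap.mem_ker.1 y.1.2
      simp [hh, hk, this]⟩, y.1 + h y.2)
    map_add' := fun x y => by
      ext
      · simp only [Prod.fst_add, Prod.snd_add, Submodule.coe_add, map_add]
        abel
      · simp only [Prod.fst_add, Prod.snd_add, Submodule.coe_add, map_add]
        abel
    map_smul' := fun c x => by
      ext
      · simp [smul_sub, smul_add]
      · simp [smul_add]
    left_inv := fun x => by
      ext <;> simp
    right_inv := fun y => by
      ext <;> simp }⟩

end Schanuel

variable {A : Type*} [CommRing A]

/-- Division by `X - T` for a square matrix `T` over `A`. -/
theorem exists_eq_X_smul_sub_mulVec {m : Type*} [Fintype m] (T : Matrix m m A) (v : m → A[X]) :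
    ∃ (u : m → A[X]) (v₀ : m → A),
      v = (Polynomial.X : A[X]) • u - T.map Polynomial.C *ᵥ u + fun i => Polynomial.C (v₀ i) := by
  classical
  let S : Set (m → A[X]) := {v | ∃ (u : m → A[X]) (v₀ : m → A),
      v = (Polynomial.X : A[X]) • u - T.map Polynomial.C *ᵥ u + fun i => Polynomial.C (v₀ i)}
  have hadd : ∀ v w, v ∈ S → w ∈ S → v + w ∈ S := by
    rintro _ _ ⟨u, v₀, rfl⟩ ⟨u', w₀, rfl⟩
    refine ⟨u + u', v₀ + w₀, ?_⟩
    ext1 i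
    simp only [Pi.add_apply, Pi.sub_apply, mulVec_add, smul_add, map_add]
    ring
  have hconst : ∀ v₀ : m → A, (fun i => Polynomial.C (v₀ i)) ∈ S := fun v₀ => ⟨0, v₀, by simp⟩
  have hX : ∀ v, v ∈ S → (Polynomial.X : A[X]) • v ∈ S := by
    rintro v ⟨u, v₀, hv⟩
    have h1 : (fun i => Polynomial.C ((T *ᵥ v₀) i)) =
        T.map Polynomial.C *ᵥ fun i => Polynomial.C (v₀ i) := by
      ext1 i
      exact RingHom.map_mulVec _ _ _ _
    refine ⟨(Polynomial.X : A[X]) • u + fun i => Polynomial.C (v₀ i), T *ᵥ v₀, ?_⟩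
    rw [h1, hv, mulVec_add, mulVec_smul, smul_add, smul_add, smul_sub]
    abel
  have hmon : ∀ (k : ℕ) (v₀ : m → A),
      (Polynomial.X ^ k : A[X]) • (fun i => Polynomial.C (v₀ i)) ∈ S := by
    intro k v₀
    induction k with
    | zero => simpa using hconst v₀
    | succ k ih => simpa [pow_succ', mul_smul] using hX _ ih
  have hsingle : ∀ (i : m) (p : A[X]), Pi.single i p ∈ S := by
    intro i p
    induction p using Polynomial.induction_on' with
    | add p q hp hq =>
      rw [Pi.single_add]
      exact hadd _ _ hp hq
    | monomial k a =>
      convert hmon k (Pi.single i a) using 1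
      ext1 j
      by_cases hj : j = i
      · subst hj
        simp [Polynomial.X_pow_mul_C, Polynomial.C_mul_X_pow_eq_monomial]
      · simp [hj]
  have hfin : ∀ s : Finset m, ∑ i ∈ s, Pi.single i (v i) ∈ S := by
    intro s
    induction s using Finset.induction_on with
    | empty => exact ⟨0, 0, by ext1 i; simp⟩
    | insert i s hi ih =>
      rw [Finset.sum_insert hi]
      exact hadd _ _ (hsingle _ _) ih
  have := hfin Finset.univ
  rwa [Finset.univ_sum_single] at this

/-- Uniqueness in division by `X - T`. -/
theorem eq_zero_of_X_smul_eq_mulVec_add {m : Type*} [Fintype m] (T : Matrix m m A) (u : m → A[X])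
    (v₀ : m → A)
    (h : (Polynomial.X : A[X]) • u = T.map Polynomial.C *ᵥ u + fun i => Polynomial.C (v₀ i)) :
    u = 0 := by
  have hrec : ∀ k i, (u i).coeff k = (T *ᵥ fun j => (u j).coeff (k + 1)) i := by
    intro k i
    have := congrArg (fun p : A[X] => p.coeff (k + 1)) (congrFun h i)
    simpa [mulVec, dotProduct, Polynomial.finsetSum_coeff, Polynomial.coeff_X_mul,
      Polynomial.coeff_C] using this
  let D := ∑ i, ((u i).natDegree + 1)
  have hD : ∀ k, D ≤ k → ∀ i, (u i).coeff k = 0 := by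
    intro k hk i
    apply Polynomial.coeff_eq_zero_of_natDegree_lt
    have := Finset.single_le_sum (f := fun i => (u i).natDegree + 1) (fun _ _ => Nat.zero_le _)
      (Finset.mem_univ i)
    omega
  have hall : ∀ l k, D ≤ k + l → ∀ i, (u i).coeff k = 0 := by
    intro l
    induction l with
    | zero => exact hD
    | succ l ih =>
      intro k hk i
      rw [hrec, show (fun j => (u j).coeff (k + 1)) = 0 from funext (ih (k + 1) (by omega))]
      simp
  ext i k
  exact hall D k (by omega) i

/-- Let `N` be an `A[X]`-module with a presentation `0 → A^l → A^m → N → 0` over `A`. Then the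
kernel of the induced map `A[X]^m → N` is stably free if it is projective. Writing `T`, `T₁` for
lifts of `X` to endomorphisms of `A^m` and `A^l`, and `b` for the inclusion, this kernel is the
cokernel of `(-b, X - T₁) : A[X]^l → A[X]^m ⊕ A[X]^l`. -/
theorem nonempty_ker_equiv_of_presentation {N : Type*} [AddCommGroup N] [Module A[X] N] [Module A N]
    [IsScalarTower A A[X] N] {m l : ℕ} (q : (Fin m → A) →ₗ[A] N) (hq : Function.Surjective q)
    (b : (Fin l → A) →ₗ[A] (Fin m → A)) (hb : Function.Injective b)
    (hbq : LinearMap.range b = LinearMap.ker q) (π : (Fin m → A[X]) →ₗ[A[X]] N)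
    (hπ : ∀ v₀ : Fin m → A, π (fun i => Polynomial.C (v₀ i)) = q v₀)
    [Module.Projective A[X] (LinearMap.ker π)] :
    Nonempty ((LinearMap.ker π × (Fin l → A[X])) ≃ₗ[A[X]] ((Fin m → A[X]) × (Fin l → A[X]))) := by
  classical
  let B : Matrix (Fin m) (Fin l) A := LinearMap.toMatrix' b
  have hB : ∀ x, B *ᵥ x = b x := fun x => LinearMap.toMatrix'_mulVec _ _
  choose t ht using fun i : Fin m => hq ((Polynomial.X : A[X]) • q (Pi.single i 1))
  let T : Matrix (Fin m) (Fin m) A := Matrix.of fun i j => t j i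
  have hT : ∀ x, q (T *ᵥ x) = (Polynomial.X : A[X]) • q x := by
    intro x
    have h1 : T *ᵥ x = ∑ j, x j • t j := by
      ext i
      simp [T, mulVec, dotProduct, mul_comm]
    have h2 : x = ∑ j, x j • Pi.single j (1 : A) := by
      ext i
      simp [Finset.sum_apply, Pi.single_apply]
    conv_rhs => rw [h2]
    rw [h1, map_sum, map_sum, Finset.smul_sum]
    refine Finset.sum_congr rfl fun j _ => ?_
    rw [map_smul, map_smul, ht, smul_comm]
  have hlift : ∀ j : Fin l, ∃ y, b y = T *ᵥ (B *ᵥ Pi.single j 1) := by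
    intro j
    have : T *ᵥ (B *ᵥ Pi.single j 1) ∈ LinearMap.ker q := by
      rw [LinearMap.mem_ker, hT, hB]
      have : b (Pi.single j 1) ∈ LinearMap.ker q := hbq ▸ LinearMap.mem_range_self _ _
      rw [LinearMap.mem_ker.1 this, smul_zero]
    rwa [← hbq] at this
  choose t₁ ht₁ using hlift
  let T₁ : Matrix (Fin l) (Fin l) A := Matrix.of fun i j => t₁ j i
  have hTB : T * B = B * T₁ := by
    ext i j
    have h1 : T₁ *ᵥ Pi.single j 1 = t₁ j := by
      ext k
      simp [T₁]
    have h2 := ht₁ j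
    rw [← hB, ← h1, mulVec_mulVec, mulVec_mulVec] at h2
    simpa using (congrFun h2 i).symm
  let c : A →+* A[X] := Polynomial.C
  have hTB' : T.map c * B.map c = B.map c * T₁.map c := by
    rw [← Matrix.map_mul, hTB, Matrix.map_mul]
  have hπT : ∀ u : Fin m → A[X], π (T.map c *ᵥ u) = (Polynomial.X : A[X]) • π u := by
    intro u
    suffices h : π ∘ₗ (T.map c).mulVecLin = (Polynomial.X : A[X]) • π from LinearMap.congr_fun h u
    refine (Pi.basisFun A[X] (Fin m)).ext fun i => ?_
    have h1 : (Pi.single i 1 : Fin m → A[X]) =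
        fun j => Polynomial.C ((Pi.single i 1 : Fin m → A) j) := by
      ext1 j
      rw [Pi.single_apply, Pi.single_apply]
      split_ifs <;> simp
    have h2 : T.map c *ᵥ (fun j => Polynomial.C ((Pi.single i 1 : Fin m → A) j)) =
        fun j => Polynomial.C ((T *ᵥ Pi.single i 1) j) := by
      ext1 j
      exact (RingHom.map_mulVec c T _ j).symm
    rw [Pi.basisFun_apply, h1]
    simp only [LinearMap.comp_apply, mulVecLin_apply, LinearMap.smul_apply]
    rw [h2, hπ, hπ, hT]
  have hπB : ∀ w : Fin l → A[X], π (B.map c *ᵥ w) = 0 := by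
    intro w
    suffices h : π ∘ₗ (B.map c).mulVecLin = 0 from LinearMap.congr_fun h w
    refine (Pi.basisFun A[X] (Fin l)).ext fun i => ?_
    have h1 : (Pi.single i 1 : Fin l → A[X]) =
        fun j => Polynomial.C ((Pi.single i 1 : Fin l → A) j) := by
      ext1 j
      rw [Pi.single_apply, Pi.single_apply]
      split_ifs <;> simp
    have h2 : B.map c *ᵥ (fun j => Polynomial.C ((Pi.single i 1 : Fin l → A) j)) =
        fun j => Polynomial.C ((B *ᵥ Pi.single i 1) j) := by
      ext1 j
      exact (RingHom.map_mulVec c B _ j).symm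
    have h3 : b (Pi.single i 1) ∈ LinearMap.ker q := hbq ▸ LinearMap.mem_range_self _ _
    rw [Pi.basisFun_apply, h1]
    simp only [LinearMap.comp_apply, mulVecLin_apply, LinearMap.zero_apply]
    rw [h2, hπ, hB]
    exact h3
  let ρ₀ : ((Fin m → A[X]) × (Fin l → A[X])) →ₗ[A[X]] (Fin m → A[X]) :=
    LinearMap.coprod ((Polynomial.X : A[X]) • LinearMap.id - (T.map c).mulVecLin)
      (B.map c).mulVecLin
  have hρ₀ : ∀ u w, ρ₀ (u, w) = (Polynomial.X : A[X]) • u - T.map c *ᵥ u + B.map c *ᵥ w := by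
    intro u w
    simp [ρ₀]
  let ρ : ((Fin m → A[X]) × (Fin l → A[X])) →ₗ[A[X]] LinearMap.ker π :=
    ρ₀.codRestrict _ (by
      rintro ⟨u, w⟩
      rw [LinearMap.mem_ker, hρ₀, map_add, map_sub, map_smul, hπT, hπB]
      simp)
  have hρ : Function.Surjective ρ := by
    rintro ⟨z, hz⟩
    obtain ⟨u, z₀, hu⟩ := exists_eq_X_smul_sub_mulVec T z
    have hz₀ : z₀ ∈ LinearMap.ker q := by
      rw [LinearMap.mem_ker, ← hπ]
      have := LinearMap.mem_ker.1 hz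
      rw [hu, map_add, map_sub, map_smul] at this
      erw [hπT] at this
      simpa using this
    rw [← hbq] at hz₀
    obtain ⟨w, rfl⟩ := hz₀
    refine ⟨(u, fun i => Polynomial.C (w i)), Subtype.ext ?_⟩
    change ρ₀ _ = z
    rw [hρ₀, hu]
    congr 1
    ext1 i
    rw [← hB]
    exact (RingHom.map_mulVec c B w i).symm
  let κ : (Fin l → A[X]) →ₗ[A[X]] ((Fin m → A[X]) × (Fin l → A[X])) :=
    LinearMap.prod (-(B.map c).mulVecLin)
      ((Polynomial.X : A[X]) • LinearMap.id - (T₁.map c).mulVecLin)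
  have hκ : ∀ v, κ v = (-(B.map c *ᵥ v), (Polynomial.X : A[X]) • v - T₁.map c *ᵥ v) := by
    intro v
    simp [κ]
  have hκi : Function.Injective κ := by
    rw [injective_iff_map_eq_zero]
    intro v hv
    rw [hκ] at hv
    apply eq_zero_of_X_smul_eq_mulVec_add T₁ v 0
    have := congrArg Prod.snd hv
    simp only [Prod.snd_zero, sub_eq_zero] at this
    rw [this]
    ext1 i
    simp [c]
  have hκr : LinearMap.range κ = LinearMap.ker ρ := by
    apply le_antisymm
    · rintro _ ⟨v, rfl⟩
      rw [LinearMap.mem_ker]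
      apply Subtype.ext
      change ρ₀ _ = 0
      rw [hκ, hρ₀, mulVec_sub, mulVec_neg, mulVec_smul, mulVec_mulVec, mulVec_mulVec, hTB']
      simp
    · rintro ⟨u, w⟩ hu
      have hu : ρ₀ (u, w) = 0 := congrArg Subtype.val (LinearMap.mem_ker.1 hu)
      rw [hρ₀] at hu
      obtain ⟨v, w₀, hw⟩ := exists_eq_X_smul_sub_mulVec T₁ w
      have hBw : B.map c *ᵥ (fun i => Polynomial.C (w₀ i)) =
          fun i => Polynomial.C ((B *ᵥ w₀) i) := by
        ext1 i
        exact (RingHom.map_mulVec c B w₀ i).symm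
      have hBw' : B.map c *ᵥ w = (Polynomial.X : A[X]) • (B.map c *ᵥ v) -
          T.map c *ᵥ (B.map c *ᵥ v) + fun i => Polynomial.C ((B *ᵥ w₀) i) := by
        rw [hw, mulVec_add, hBw, mulVec_sub, mulVec_smul, mulVec_mulVec, mulVec_mulVec, hTB']
      have huv : u + B.map c *ᵥ v = 0 := by
        apply eq_zero_of_X_smul_eq_mulVec_add T _ (-(B *ᵥ w₀))
        have : (fun i => Polynomial.C ((-(B *ᵥ w₀)) i)) =
            -fun i => (Polynomial.C ((B *ᵥ w₀) i) : A[X]) := by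
          ext1 i
          simp
        rw [this, mulVec_add, smul_add, ← sub_eq_zero, ← hu, hBw']
        abel
      have hw₀ : w₀ = 0 := by
        apply hb
        rw [← hB, map_zero]
        ext i
        have h1 : (Polynomial.X : A[X]) • (u + B.map c *ᵥ v) - T.map c *ᵥ (u + B.map c *ᵥ v) +
            (fun i => Polynomial.C ((B *ᵥ w₀) i)) = 0 := by
          rw [mulVec_add, smul_add, ← hu, hBw']
          abel
        rw [huv] at h1
        simpa using congrFun h1 i
      refine ⟨v, ?_⟩
      rw [hκ, hw, hw₀]
      ext1
      · exact (eq_neg_of_add_eq_zero_left huv).symm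
      · ext1 i
        simp [c]
  obtain ⟨e⟩ := nonempty_schanuel_equiv ρ (LinearMap.id : LinearMap.ker π →ₗ[A[X]] _) hρ
    Function.surjective_id
  have e₁ : (Fin l → A[X]) ≃ₗ[A[X]] LinearMap.ker ρ :=
    (LinearEquiv.ofInjective κ hκi).trans (LinearEquiv.ofEq _ _ hκr)
  have : Subsingleton (LinearMap.ker (LinearMap.id : LinearMap.ker π →ₗ[A[X]] _)) := by
    rw [LinearMap.ker_id]
    infer_instance
  have : Unique (LinearMap.ker (LinearMap.id : LinearMap.ker π →ₗ[A[X]] _)) :=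
    uniqueOfSubsingleton 0
  exact ⟨(LinearEquiv.prodComm _ _ _).trans ((e₁.prodCongr (LinearEquiv.refl _ _)).trans
    (e.trans LinearEquiv.uniqueProd))⟩

end Resolutions

section StablyFree

open Matrix
open scoped Polynomial

/-! ### Projective modules over `A[X]` that are free up to a monic polynomial -/

theorem finite_of_monic_smul_eq_zero {A N : Type*} [CommRing A] [AddCommGroup N] [Module A[X] N]
    [Module A N] [IsScalarTower A A[X] N] [Module.Finite A[X] N] {g : A[X]} (hg : g.Monic)
    (h : ∀ x : N, g • x = 0) : Module.Finite A N := by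
  rcases subsingleton_or_nontrivial A with hA | hA
  · have := Module.subsingleton A N
    infer_instance
  obtain ⟨n, f, hf⟩ := Module.Finite.exists_fin' A[X] N
  refine Module.Finite.of_surjective (f.restrictScalars A ∘ₗ
    ((Polynomial.degreeLT A g.natDegree).subtype.compLeft (Fin n))) fun x => ?_
  obtain ⟨v, rfl⟩ := hf x
  refine ⟨fun i => ⟨v i %ₘ g, ?_⟩, ?_⟩
  · rw [Polynomial.mem_degreeLT, ← Polynomial.degree_eq_natDegree hg.ne_zero]
    exact Polynomial.degree_modByMonic_lt _ hg
  · change f (fun i => v i %ₘ g) = f v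
    have : v = (fun i => v i %ₘ g) + g • fun i => v i /ₘ g := by
      ext1 i
      exact (Polynomial.modByMonic_add_div _ g).symm
    conv_rhs => rw [this]
    rw [map_add, map_smul, h, add_zero]

theorem projective_restrictScalars {A P : Type*} [CommRing A] [AddCommGroup P] [Module A[X] P]
    [Module A P] [IsScalarTower A A[X] P] [Module.Finite A[X] P] [Module.Projective A[X] P] :
    Module.Projective A P := by
  obtain ⟨n, p, s, -, -, hps⟩ := Module.Finite.exists_comp_eq_id_of_projective A[X] P
  refine Module.Projective.of_split (s.restrictScalars A) (p.restrictScalars A) ?_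
  ext x
  exact LinearMap.congr_fun hps x

/-- A projective `A[X]`-module containing a free module `F` with quotient killed by a monic
polynomial is stably free. The quotient `N = P / F` is finite over `A` of projective dimension at
most `1`, and Schanuel's lemma compares `0 → F → P → N → 0` with the resolution of
`nonempty_ker_equiv_of_presentation`. -/
theorem exists_free_prod_of_monic {A P : Type*} [CommRing A] [IsNoetherianRing A]
    (hA : IdempotentsSplit A) [AddCommGroup P] [Module A[X] P] [Module A P]
    [IsScalarTower A A[X] P] [Module.Finite A[X] P] [Module.Projective A[X] P]
    (F : Submodule A[X] P) [Module.Finite A[X] F] [Module.Free A[X] F] {g : A[X]} (hg : g.Monic)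
    (h : ∀ x : P, g • x ∈ F) : ∃ s : ℕ, Module.Free A[X] (P × (Fin s → A[X])) := by
  let N := P ⧸ F
  have hN : Module.Finite A N := finite_of_monic_smul_eq_zero hg fun x => by
    obtain ⟨x, rfl⟩ := F.mkQ_surjective x
    rw [← map_smul, ← LinearMap.mem_ker, Submodule.ker_mkQ]
    exact h x
  obtain ⟨m, q, hq⟩ := Module.Finite.exists_fin' A N
  -- the kernel of `A^m → N` is projective over `A`, hence free
  have hPA : Module.Projective A P := projective_restrictScalars
  have hFA : Module.Projective A F := projective_restrictScalars
  have hker : LinearMap.ker (F.mkQ.restrictScalars A) = F.restrictScalars A := by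
    ext x
    simp
  have hFA' : Module.Projective A (LinearMap.ker (F.mkQ.restrictScalars A)) := by
    rw [hker]
    exact hFA
  obtain ⟨e⟩ := nonempty_schanuel_equiv (F.mkQ.restrictScalars A) q F.mkQ_surjective hq
  have hQ : Module.Projective A (LinearMap.ker q) := by
    refine Module.Projective.of_split (e.symm.toLinearMap ∘ₗ LinearMap.inl A _ _)
      (LinearMap.fst A _ _ ∘ₗ e.toLinearMap) (LinearMap.ext fun x => ?_)
    change (e (e.symm (x, 0))).1 = x
    rw [e.apply_symm_apply]
  have hQfree : Module.Free A (LinearMap.ker q) := hA.free _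
  have : ∃ (l : ℕ) (b : (Fin l → A) →ₗ[A] (Fin m → A)), Function.Injective b ∧
      LinearMap.range b = LinearMap.ker q := by
    rcases subsingleton_or_nontrivial A with hA | hA
    · refine ⟨0, 0, fun _ _ _ => Subsingleton.elim _ _, Subsingleton.elim _ _⟩
    · let b := Module.finBasis A (LinearMap.ker q)
      refine ⟨_, (LinearMap.ker q).subtype ∘ₗ b.equivFun.symm.toLinearMap, ?_, ?_⟩
      · exact Subtype.val_injective.comp b.equivFun.symm.injective
      · rw [LinearMap.range_comp_of_range_eq_top _ (LinearEquiv.range _), Submodule.range_subtype]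
  obtain ⟨l, b, hb, hbq⟩ := this
  let π : (Fin m → A[X]) →ₗ[A[X]] N := Fintype.linearCombination A[X] fun i => q (Pi.single i 1)
  have hπ : ∀ v₀ : Fin m → A, π (fun i => Polynomial.C (v₀ i)) = q v₀ := by
    intro v₀
    have h2 : v₀ = ∑ j, v₀ j • Pi.single j (1 : A) := by
      ext i
      simp [Finset.sum_apply, Pi.single_apply]
    conv_rhs => rw [h2]
    rw [Fintype.linearCombination_apply, map_sum]
    refine Finset.sum_congr rfl fun j _ => ?_
    rw [map_smul, ← algebraMap_smul A[X] (v₀ j)]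
    rfl
  have hπs : Function.Surjective π := by
    intro x
    obtain ⟨v₀, rfl⟩ := hq x
    exact ⟨_, hπ v₀⟩
  obtain ⟨e₁⟩ := nonempty_schanuel_equiv F.mkQ π F.mkQ_surjective hπs
  let e₀ : F ≃ₗ[A[X]] LinearMap.ker F.mkQ := LinearEquiv.ofEq _ _ F.ker_mkQ.symm
  have hK : Module.Projective A[X] (LinearMap.ker π) := by
    have : Module.Projective A[X] (LinearMap.ker F.mkQ) := Module.Projective.of_equiv' e₀
    refine Module.Projective.of_split (e₁.symm.toLinearMap ∘ₗ LinearMap.inl A[X] _ _)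
      (LinearMap.fst A[X] _ _ ∘ₗ e₁.toLinearMap) (LinearMap.ext fun x => ?_)
    simp
  obtain ⟨e₂⟩ := nonempty_ker_equiv_of_presentation q hq b hb hbq π hπ
  have hfree : Module.Free A[X] (LinearMap.ker F.mkQ) := Module.Free.of_equiv e₀
  refine ⟨m + l, ?_⟩
  -- `P ⊕ A[X]^(m + l) ≃ P ⊕ K ⊕ A[X]^l ≃ F ⊕ A[X]^m ⊕ A[X]^l`, where `K = ker π`
  have e₃ : ((LinearMap.ker F.mkQ × (Fin m → A[X])) × (Fin l → A[X])) ≃ₗ[A[X]]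
      (P × (Fin (m + l) → A[X])) :=
    (e₁.prodCongr (LinearEquiv.refl A[X] (Fin l → A[X]))).trans
      (((LinearEquiv.prodComm A[X] (LinearMap.ker π) P).prodCongr
        (LinearEquiv.refl A[X] (Fin l → A[X]))).trans
      ((LinearEquiv.prodAssoc A[X] P (LinearMap.ker π) (Fin l → A[X])).trans
        ((LinearEquiv.refl A[X] P).prodCongr (e₂.trans
          ((LinearEquiv.sumArrowLequivProdArrow (Fin m) (Fin l) A[X] A[X]).symm.trans
            (LinearEquiv.funCongrLeft A[X] A[X] finSumFinEquiv.symm))))))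
  exact Module.Free.of_equiv e₃

/-! ### Cancelling free summands -/

/-- Every unimodular vector over `R` is the first column of an invertible matrix. -/
def UnimodularCompletable (R : Type*) [CommRing R] : Prop :=
  ∀ (n : ℕ) (f : Fin (n + 1) → R), IsUnimodular f → VecEquiv f (Pi.single 0 1)

/-- An isomorphism `P × R ≃ R ^ (n + 1)` sends `(0, 1)` to a unimodular vector; when that is the
first basis vector, `P` is identified with the span of the others. -/
theorem UnimodularCompletable.free_of_prod {R P : Type*} [CommRing R] (hR : UnimodularCompletable R)
    [AddCommGroup P] [Module R P] [Module.Finite R P] [h : Module.Free R (P × R)] :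
    Module.Free R P := by
  rcases subsingleton_or_nontrivial R with hs | hs
  · exact Module.Free.of_subsingleton' R P
  obtain ⟨n, ⟨b⟩⟩ : ∃ n : ℕ, Nonempty ((P × R) ≃ₗ[R] (Fin n → R)) :=
    ⟨_, ⟨(Module.finBasis R (P × R)).equivFun⟩⟩
  rcases n with _ | n
  · have : Subsingleton (P × R) := b.toEquiv.subsingleton
    have : Subsingleton P := (Prod.mk_left_injective (0 : R)).subsingleton
    exact Module.Free.of_subsingleton R P
  have hu : IsUnimodular (b (0, 1)) := by
    refine ⟨fun i => (b.symm (Pi.single i 1)).2, ?_⟩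
    have := LinearMap.pi_apply_eq_sum_univ (LinearMap.snd R P R ∘ₗ b.symm.toLinearMap) (b (0, 1))
    simp only [LinearMap.comp_apply, LinearEquiv.coe_coe, LinearEquiv.symm_apply_apply,
      LinearMap.snd_apply, smul_eq_mul] at this
    refine Eq.trans ?_ this.symm
    rw [dotProduct]
    refine Finset.sum_congr rfl fun i _ => ?_
    have hi : (Pi.single i 1 : Fin (n + 1) → R) = fun j => if i = j then 1 else 0 := by
      ext j
      simp [Pi.single_apply, eq_comm]
    rw [mul_comm, hi]
  -- coordinates `φ` on `P × R` in which `(0, 1)` is the first basis vector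
  obtain ⟨⟨M, M', h1, h2⟩, hM⟩ := hR n (b (0, 1)) hu
  change M *ᵥ _ = _ at hM
  let φ : (P × R) →ₗ[R] (Fin (n + 1) → R) := M.mulVecLin ∘ₗ b.toLinearMap
  let ψ : (Fin (n + 1) → R) →ₗ[R] (P × R) := b.symm.toLinearMap ∘ₗ M'.mulVecLin
  have hφψ : ∀ y, φ (ψ y) = y := fun y => by simp [φ, ψ, mulVec_mulVec, h1]
  have hψφ : ∀ x, ψ (φ x) = x := fun x => by simp [φ, ψ, mulVec_mulVec, h2]
  have hφ : φ (0, 1) = Pi.single 0 1 := hM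
  have hψ : ψ (Pi.single 0 1) = (0, 1) := by rw [← hφ, hψφ]
  let c : (Fin n → R) →ₗ[R] (Fin (n + 1) → R) :=
    (Fin.consLinearEquiv R fun _ : Fin (n + 1) => R).toLinearMap ∘ₗ LinearMap.inr R R _
  have hc : ∀ y, c y = Fin.cons 0 y := fun y => rfl
  refine Module.Free.of_equiv (LinearEquiv.ofLinearMap (LinearMap.fst R P R ∘ₗ ψ ∘ₗ c)
    (LinearMap.funLeft R R Fin.succ ∘ₗ φ ∘ₗ LinearMap.inl R P R) ?_ ?_)
  · refine LinearMap.ext fun x => ?_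
    simp only [LinearMap.comp_apply, LinearMap.inl_apply, LinearMap.fst_apply, LinearMap.id_apply]
    have : c (LinearMap.funLeft R R Fin.succ (φ (x, 0))) =
        φ (x, 0) - φ (x, 0) 0 • Pi.single 0 1 := by
      ext i
      rw [hc]
      refine Fin.cases ?_ (fun i => ?_) i <;> simp [LinearMap.funLeft_apply]
    rw [this, map_sub, map_smul, hψφ, hψ]
    simp
  · refine LinearMap.ext fun y => ?_
    simp only [LinearMap.comp_apply, LinearMap.inl_apply, LinearMap.fst_apply, LinearMap.id_apply]
    have : ((ψ (c y)).1, (0 : R)) = ψ (c y) - (ψ (c y)).2 • ((0 : P), (1 : R)) := by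
      ext <;> simp
    rw [this, map_sub, map_smul, hφψ, hφ, hc]
    ext i
    simp [LinearMap.funLeft_apply]

theorem UnimodularCompletable.free_of_prod_pi {R P : Type*} [CommRing R]
    (hR : UnimodularCompletable R) [AddCommGroup P] [Module R P] [Module.Finite R P] (s : ℕ)
    (h : Module.Free R (P × (Fin s → R))) : Module.Free R P := by
  induction s with
  | zero => exact Module.Free.of_equiv (LinearEquiv.prodUnique (R := R) (M := P) (M₂ := Fin 0 → R))
  | succ s ih =>
    apply ih
    have e : (P × (Fin (s + 1) → R)) ≃ₗ[R] ((P × (Fin s → R)) × R) :=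
      ((LinearEquiv.refl R P).prodCongr ((Fin.consLinearEquiv R fun _ : Fin (s + 1) => R).symm.trans
        (LinearEquiv.prodComm R _ _))).trans (LinearEquiv.prodAssoc R _ _ _).symm
    have := Module.Free.of_equiv e
    exact hR.free_of_prod

end StablyFree

/-! ### Projective modules over polynomial rings over a field -/

section QuillenSuslin

open Matrix
open scoped Polynomial

/-- Every nonzero polynomial over `A` becomes monic up to a unit after an automorphism of the ring
`A[X]`, which need not fix `A`. -/
def MonicCoordinates (A : Type*) [CommRing A] : Prop :=
  ∀ g : A[X], g ≠ 0 → ∃ σ : A[X] ≃+* A[X], IsUnit (σ g).leadingCoeff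

theorem MonicCoordinates.of_field (k : Type*) [Field k] : MonicCoordinates k :=
  fun _ hg => ⟨RingEquiv.refl _, (Polynomial.leadingCoeff_ne_zero.2 hg).isUnit⟩

/-- Nagata's change of variables: `g ∈ A[X][T]` is viewed as a polynomial in `X` over `A[T]`, its
leading coefficient is made monic in `T`, and then `X` is replaced by `X + T ^ M` for large `M`, so
that the top power of `X` contributes the top power of `T`. -/
theorem MonicCoordinates.polynomial {A : Type*} [CommRing A] [IsDomain A]
    (hA : MonicCoordinates A) : MonicCoordinates A[X] := by
  intro g hg
  let sw := (Polynomial.Bivariate.swap (R := A)).toRingEquiv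
  have hlc : (sw g).leadingCoeff ≠ 0 := by
    rw [Polynomial.leadingCoeff_ne_zero, ne_eq, EmbeddingLike.map_eq_zero_iff]
    exact hg
  obtain ⟨σ, hσ⟩ := hA _ hlc
  let h : A[X][X] := Polynomial.mapEquiv σ (sw g)
  have hh : IsUnit h.leadingCoeff.leadingCoeff := by
    have : h.leadingCoeff = σ (sw g).leadingCoeff :=
      Polynomial.leadingCoeff_map_of_injective (f := (σ : A[X] →+* A[X])) σ.injective _
    rwa [this]
  have hh0 : h.leadingCoeff ≠ 0 := by
    rw [← Polynomial.leadingCoeff_ne_zero]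
    exact hh.ne_zero
  let M := ∑ i ∈ Finset.range (h.natDegree + 1), (h.coeff i).natDegree + 1
  let τ := (Polynomial.taylorEquiv (Polynomial.X ^ M : A[X])).toRingEquiv
  refine ⟨((sw.trans (Polynomial.mapEquiv σ)).trans τ).trans sw, ?_⟩
  change IsUnit (sw (τ h)).leadingCoeff
  let y : A[X][X] := Polynomial.C Polynomial.X + Polynomial.X ^ M
  have hM0 : M ≠ 0 := Nat.succ_ne_zero _
  have hym : y.Monic := by
    simp only [y]
    rw [add_comm]
    exact Polynomial.monic_X_pow_add_C _ hM0
  have hyd : y.natDegree = M := by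
    simp only [y]
    rw [add_comm]
    exact Polynomial.natDegree_X_pow_add_C
  have hterm : ∀ (a : A[X]) (i : ℕ), sw (τ (Polynomial.C a * Polynomial.X ^ i)) =
      a.map Polynomial.C * y ^ i := by
    intro a i
    rw [map_mul, map_mul, map_pow, map_pow]
    have h1 : τ (Polynomial.C a) = Polynomial.C a := Polynomial.taylor_C _ _
    have h2 : τ Polynomial.X = Polynomial.X + Polynomial.C (Polynomial.X ^ M) :=
      Polynomial.taylor_X _
    have h3 : sw (Polynomial.C a) = a.map Polynomial.C := Polynomial.Bivariate.swap_C a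
    have h4 : sw Polynomial.X = Polynomial.C Polynomial.X := Polynomial.Bivariate.swap_Y
    have h5 : sw (Polynomial.C (Polynomial.X ^ M)) = (Polynomial.X ^ M : A[X]).map Polynomial.C :=
      Polynomial.Bivariate.swap_C _
    rw [h1, h2, h3, map_add, h4, h5, Polynomial.map_pow, Polynomial.map_X]
  have hdeg : ∀ (a : A[X]) (i : ℕ), a ≠ 0 → (a.map Polynomial.C * y ^ i : A[X][X]).degree =
      (a.natDegree + M * i : ℕ) := by
    intro a i ha
    have ha' : (a.map Polynomial.C : A[X][X]) ≠ 0 :=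
      (Polynomial.map_ne_zero_iff Polynomial.C_injective).2 ha
    rw [Polynomial.degree_eq_natDegree (mul_ne_zero ha' (hym.pow i).ne_zero),
      Polynomial.natDegree_mul ha' (hym.pow i).ne_zero,
      Polynomial.natDegree_map_eq_of_injective Polynomial.C_injective, hym.natDegree_pow, hyd,
      mul_comm]
  have hsum : sw (τ h) = ∑ i ∈ Finset.range h.natDegree, (h.coeff i).map Polynomial.C * y ^ i +
      h.leadingCoeff.map Polynomial.C * y ^ h.natDegree := by
    conv_lhs => rw [h.as_sum_range_C_mul_X_pow]
    rw [map_sum, map_sum, Finset.sum_range_succ]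
    simp only [hterm]
    rfl
  rw [hsum, Polynomial.leadingCoeff_add_of_degree_lt, Polynomial.leadingCoeff_mul,
    (hym.pow _).leadingCoeff, mul_one,
    Polynomial.leadingCoeff_map_of_injective Polynomial.C_injective]
  · exact hh.map Polynomial.C
  · rw [hdeg _ _ hh0]
    refine (Polynomial.degree_sum_le _ _).trans_lt ((Finset.sup_lt_iff (WithBot.bot_lt_coe _)).2 ?_)
    intro i hi
    by_cases h0 : h.coeff i = 0
    · rw [h0, Polynomial.map_zero, zero_mul, Polynomial.degree_zero]
      exact WithBot.bot_lt_coe _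
    · rw [hdeg _ _ h0]
      have hi' := Finset.mem_range.1 hi
      have h1 : (h.coeff i).natDegree < M := Nat.lt_succ_of_le
        (Finset.single_le_sum (f := fun i => (h.coeff i).natDegree) (fun _ _ => Nat.zero_le _)
          (Finset.mem_range.2 (by omega)))
      have h2 : M * (i + 1) ≤ M * h.natDegree := Nat.mul_le_mul_left _ hi'
      rw [mul_add, mul_one] at h2
      exact_mod_cast (by omega : (h.coeff i).natDegree + M * i <
        h.leadingCoeff.natDegree + M * h.natDegree)

theorem UnimodularCompletable.of_field (k : Type*) [Field k] : UnimodularCompletable k := by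
  rintro n f ⟨w, hw⟩
  obtain ⟨i, hi⟩ : ∃ i, f i ≠ 0 := by
    by_contra! h
    rw [funext h] at hw
    simp at hw
  exact (VecEquiv.single_of_isUnit hi.isUnit).trans (VecEquiv.single_single i 0)

theorem monic_C_inv_mul {A : Type*} [CommRing A] {g : A[X]} (h : IsUnit g.leadingCoeff) :
    (Polynomial.C (h.unit⁻¹ : Aˣ).1 * g).Monic := by
  have := Polynomial.monic_of_isUnit_leadingCoeff_inv_smul h
  rwa [Units.smul_def, Polynomial.smul_eq_C_mul] at this

/-- After a change of coordinates some entry is monic, so that a vector of length at least three is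
equivalent to its value at `0`, a unimodular vector over `A`. Shorter vectors are completed
directly. -/
theorem UnimodularCompletable.polynomial {A : Type*} [CommRing A] [IsDomain A]
    (hA : UnimodularCompletable A) (hm : MonicCoordinates A) : UnimodularCompletable A[X] := by
  intro n f hf
  match n, f, hf with
  | 0, f, hf =>
    obtain ⟨w, hw⟩ := hf
    rw [dotProduct, Fin.sum_univ_one] at hw
    exact VecEquiv.single_of_isUnit (IsUnit.of_mul_eq_one_right _ hw)
  | 1, f, hf => exact VecEquiv.single_two hf
  | n + 2, f, hf =>
    obtain ⟨i, hi⟩ : ∃ i, f i ≠ 0 := by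
      obtain ⟨w, hw⟩ := hf
      by_contra! h
      rw [funext h] at hw
      simp at hw
    obtain ⟨σ, hσ⟩ := hm _ hi
    let c : A[X]ˣ := Units.map Polynomial.C.toMonoidHom hσ.unit⁻¹
    let f₁ : Fin (n + 2 + 1) → A[X] := fun j => σ (f j)
    have hf₁ : IsUnimodular f₁ := hf.map (σ : A[X] →+* A[X])
    have e₁ : VecEquiv f₁ (c.1 • f₁) := VecEquiv.smul f₁ c
    have hι : ∀ i j : Fin (n + 2 + 1), ∃ l, l ≠ i ∧ l ≠ j := by
      intro i j
      obtain ⟨l, hl⟩ := Finset.exists_mem_notMem_of_card_lt_card (s := {i, j})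
        (t := (Finset.univ : Finset (Fin (n + 2 + 1)))) (by
          rw [Finset.card_univ, Fintype.card_fin]
          exact Finset.card_le_two.trans_lt (by omega))
      exact ⟨l, by simpa using hl.2⟩
    have e₂ := VecEquiv.eval_zero_of_monic hι (c.1 • f₁) (hf₁.of_vecEquiv e₁) i
      (monic_C_inv_mul hσ)
    have hf₂ : IsUnimodular fun j => ((c.1 • f₁) j).eval 0 :=
      (hf₁.of_vecEquiv e₁).map (Polynomial.evalRingHom 0)
    have e₃ := (hA _ _ hf₂).map (Polynomial.C : A →+* A[X])
    have e₄ := ((e₁.trans e₂).trans e₃).map (σ.symm : A[X] →+* A[X])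
    convert e₄ using 1
    · ext1 j
      simp [f₁]
    · ext1 j
      by_cases hj : j = 0
      · subst hj
        simp
      · simp [hj]

/-- The inductive step of the Quillen–Suslin theorem. Over the field of fractions the image of an
idempotent has a basis; clearing denominators gives a free submodule whose quotient is killed by
a nonzero polynomial, which is monic in suitable coordinates. Hence the image is stably free, and
free because unimodular vectors over `A[X]` are completable. -/
theorem IdempotentsSplit.polynomial {A : Type*} [CommRing A] [IsDomain A] [IsNoetherianRing A]
    (hA : IdempotentsSplit A) (hm : MonicCoordinates A) (hu : UnimodularCompletable A[X]) :
    IdempotentsSplit A[X] := by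
  intro n e he
  obtain ⟨d, r, B, C, hd, hBC, hCB, heB, -⟩ := (IdempotentsSplit.of_field
    (FractionRing A[X])).exists_split_up_to (algebraMap A[X] (FractionRing A[X]))
    (IsFractionRing.injective _ _) (fun d => d ≠ 0) (fun s => by
      obtain ⟨b, hb⟩ := IsLocalization.exist_integer_multiples_of_finset (nonZeroDivisors A[X]) s
      refine ⟨b, nonZeroDivisors.coe_ne_zero b, fun q hq => ?_⟩
      obtain ⟨z, hz⟩ := hb q hq
      exact ⟨z, by rw [hz, Algebra.smul_def]⟩) e he
  obtain ⟨σ, hσ⟩ := hm d hd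
  -- after applying `σ`, the image of `e` contains a free module up to a monic polynomial
  let e' := e.map σ
  have he' : e' * e' = e' := by
    simp only [e']
    rw [← Matrix.map_mul, he]
  have hsm : ∀ {m l : ℕ} (c : A[X]) (D : Matrix (Fin m) (Fin l) A[X]),
      (c • D).map σ = σ c • D.map σ := fun c D => by
    ext1 i j
    simp
  have hBC' : B.map σ * C.map σ = σ d ^ 2 • e' := by rw [← Matrix.map_mul, hBC, hsm, map_pow]
  have hCB' : C.map σ * B.map σ = σ d ^ 2 • 1 := by
    rw [← Matrix.map_mul, hCB, hsm, map_pow, Matrix.map_one _ (map_zero σ) (map_one σ)]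
  have heB' : e' * B.map σ = B.map σ := by
    simp only [e']
    rw [← Matrix.map_mul, heB]
  let P := LinearMap.range e'.mulVecLin
  have hP : Module.Projective A[X] P := projective_range he'
  let ι : (Fin r → A[X]) →ₗ[A[X]] P := (B.map σ).mulVecLin.codRestrict P fun x => by
    refine ⟨B.map σ *ᵥ x, ?_⟩
    rw [mulVecLin_apply, mulVec_mulVec, heB', mulVecLin_apply]
  have hd2 : σ d ^ 2 ≠ 0 := pow_ne_zero _ (by
    rw [← Polynomial.leadingCoeff_ne_zero]
    exact hσ.ne_zero)
  have hι : Function.Injective ι := by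
    rw [injective_iff_map_eq_zero]
    intro x hx
    have h1 : B.map σ *ᵥ x = 0 := congrArg Subtype.val hx
    have h2 : (C.map σ * B.map σ) *ᵥ x = 0 := by rw [← mulVec_mulVec, h1, mulVec_zero]
    rw [hCB', smul_mulVec, one_mulVec] at h2
    exact (smul_eq_zero.1 h2).resolve_left hd2
  have hF : Module.Free A[X] (LinearMap.range ι) :=
    Module.Free.of_equiv (LinearEquiv.ofInjective ι hι)
  have hu2 : IsUnit (σ d ^ 2).leadingCoeff := by
    rw [Polynomial.leadingCoeff_pow]
    exact hσ.pow 2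
  obtain ⟨s, hs⟩ := exists_free_prod_of_monic hA (LinearMap.range ι) (monic_C_inv_mul hu2) (by
    rintro ⟨x, hx⟩
    rw [mul_smul]
    refine Submodule.smul_mem _ _ ⟨C.map σ *ᵥ x, Subtype.ext ?_⟩
    change B.map σ *ᵥ (C.map σ *ᵥ x) = σ d ^ 2 • x
    rw [mulVec_mulVec, hBC', smul_mulVec, mulVec_eq_self_of_mem_range he' hx])
  have hfree : Module.Free A[X] P := hu.free_of_prod_pi s hs
  obtain ⟨t, B₁, C₁, h1, h2⟩ := exists_split_of_free_range e' he'
  refine ⟨t, B₁.map σ.symm, C₁.map σ.symm, ?_, ?_⟩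
  · rw [← Matrix.map_mul, h1]
    ext1 i j
    simp [e']
  · rw [← Matrix.map_mul, h2, Matrix.map_one _ (map_zero σ.symm) (map_one σ.symm)]

/-- The **Quillen–Suslin theorem** over a field. -/
theorem IdempotentsSplit.mvPolynomial (k : Type u) [Field k] (n : ℕ) :
    IdempotentsSplit (MvPolynomial (Fin n) k) := by
  suffices h : ∃ (A : Type u) (_ : CommRing A) (_ : IsDomain A) (_ : IsNoetherianRing A),
      Nonempty (A ≃+* MvPolynomial (Fin n) k) ∧ IdempotentsSplit A ∧ UnimodularCompletable A ∧
        MonicCoordinates A by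
    obtain ⟨A, _, _, _, ⟨φ⟩, hA, -⟩ := h
    exact hA.of_ringEquiv φ
  induction n with
  | zero =>
    exact ⟨k, inferInstance, inferInstance, inferInstance,
      ⟨(MvPolynomial.isEmptyRingEquiv k (Fin 0)).symm⟩, IdempotentsSplit.of_field k,
      UnimodularCompletable.of_field k, MonicCoordinates.of_field k⟩
  | succ n ih =>
    obtain ⟨A, _, _, _, ⟨φ⟩, h1, h2, h3⟩ := ih
    exact ⟨A[X], inferInstance, inferInstance, inferInstance,
      ⟨(Polynomial.mapEquiv φ).trans (MvPolynomial.finSuccEquiv k n).symm.toRingEquiv⟩,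
      h1.polynomial h3 (h2.polynomial h3), h2.polynomial h3, h3.polynomial⟩

theorem IdempotentsSplit.perfLaurent_of_le (k : Type u) [Field k] (p : ℕ) [Fact p.Prime] {n r : ℕ}
    (h : r ≤ n) : IdempotentsSplit (PerfLaurent k p n r) := by
  obtain ⟨s, rfl⟩ := Nat.exists_eq_add_of_le h
  exact IdempotentsSplit.perfLaurent k p r s
    (IdempotentsSplit.of_polynomial IdempotentsSplit.mvPolynomial s k r)

end QuillenSuslin

/-! ### Multiplicativity of the Gauss norm -/

section PerfTate

open Filter Topology

section GaussNorm

variable {K : Type*} [NontriviallyNormedField K] [IsUltrametricDist K] {n : ℕ}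

theorem TateAlgebra.norm_coeff_le (f : TateAlgebra K n) (t : Fin n →₀ ℕ) :
    ‖MvPowerSeries.coeff t (f : MvPowerSeries (Fin n) K)‖ ≤ ‖f‖ := by
  rw [norm_def, gauss_eq]
  exact le_ciSup (tendsto_coeff f).bddAbove_range_of_cofinite t

theorem TateAlgebra.norm_le {f : TateAlgebra K n} {c : ℝ}
    (h : ∀ t, ‖MvPowerSeries.coeff t (f : MvPowerSeries (Fin n) K)‖ ≤ c) : ‖f‖ ≤ c := by
  rw [norm_def, gauss_eq]
  exact ciSup_le h

theorem TateAlgebra.finite_le_norm_coeff (f : TateAlgebra K n) {c : ℝ} (hc : 0 < c) :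
    {t | c ≤ ‖MvPowerSeries.coeff t (f : MvPowerSeries (Fin n) K)‖}.Finite := by
  have h := eventually_cofinite.1 ((tendsto_coeff f).eventually (gt_mem_nhds hc))
  simpa only [not_lt] using h

/-- The supremum defining the Gauss norm is attained at a lexicographically largest index. -/
theorem TateAlgebra.exists_max_norm_coeff {f : TateAlgebra K n} (hf : f ≠ 0) :
    ∃ i, ‖MvPowerSeries.coeff i (f : MvPowerSeries (Fin n) K)‖ = ‖f‖ ∧
      ∀ t, toLex i < toLex t →
        ‖MvPowerSeries.coeff t (f : MvPowerSeries (Fin n) K)‖ < ‖f‖ := by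
  have hpos : 0 < ‖f‖ := norm_pos_iff.2 hf
  obtain ⟨i, hi⟩ : ∃ i, ‖MvPowerSeries.coeff i (f : MvPowerSeries (Fin n) K)‖ = ‖f‖ := by
    -- only finitely many coefficients have norm at least `‖f‖ / 2`
    have hfin := f.finite_le_norm_coeff (half_pos hpos)
    have hne : hfin.toFinset.Nonempty := by
      by_contra hcon
      rw [Finset.not_nonempty_iff_eq_empty] at hcon
      have : ‖f‖ ≤ ‖f‖ / 2 := TateAlgebra.norm_le fun t => by
        by_contra! ht
        have : t ∈ hfin.toFinset := hfin.mem_toFinset.2 ht.le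
        simp [hcon] at this
      linarith
    obtain ⟨i, hi, hmax⟩ := Finset.exists_max_image hfin.toFinset
      (fun t => ‖MvPowerSeries.coeff t (f : MvPowerSeries (Fin n) K)‖) hne
    refine ⟨i, le_antisymm (f.norm_coeff_le i) (TateAlgebra.norm_le fun t => ?_)⟩
    by_cases ht : ‖f‖ / 2 ≤ ‖MvPowerSeries.coeff t (f : MvPowerSeries (Fin n) K)‖
    · exact hmax t (hfin.mem_toFinset.2 ht)
    · exact (not_le.1 ht).le.trans (hfin.mem_toFinset.1 hi)
  have hfin := f.finite_le_norm_coeff hpos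
  obtain ⟨j, hj, hmax⟩ := Finset.exists_max_image hfin.toFinset toLex
    ⟨i, hfin.mem_toFinset.2 hi.ge⟩
  refine ⟨j, le_antisymm (f.norm_coeff_le j) (hfin.mem_toFinset.1 hj), fun t ht => ?_⟩
  by_contra! h
  exact ht.not_ge (hmax t (hfin.mem_toFinset.2 h))

/-- The product of the lexicographically last terms of maximal norm of `f` and `g` dominates every
other contribution to its coefficient of `f * g`. -/
theorem TateAlgebra.norm_mul_eq (f g : TateAlgebra K n) : ‖f * g‖ = ‖f‖ * ‖g‖ := by
  rcases eq_or_ne f 0 with rfl | hf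
  · simp
  rcases eq_or_ne g 0 with rfl | hg
  · simp
  obtain ⟨i, hi, hi'⟩ := exists_max_norm_coeff hf
  obtain ⟨j, hj, hj'⟩ := exists_max_norm_coeff hg
  refine MvPowerSeries.gaussNorm_mul_eq_mul _ _ _ _ (hasGaussNorm f) (hasGaussNorm g)
    (hasGaussNorm (f * g)) norm_nonneg norm_zero IsUltrametricDist.isNonarchimedean_norm norm_mul
    norm_neg (fun _ => norm_eq_zero.1) (fun _ => one_pos) ⟨i, j, ?_, ?_, ?_⟩
  · simpa [MvPowerSeries.AchievesGaussNorm, Finsupp.prod, norm_def, gauss] using hi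
  · simpa [MvPowerSeries.AchievesGaussNorm, Finsupp.prod, norm_def, gauss] using hj
  · rintro ⟨a, b⟩ hab hne
    rw [Finset.HasAntidiagonal.mem_antidiagonal] at hab
    have hf0 : 0 < ‖f‖ := norm_pos_iff.2 hf
    have hg0 : 0 < ‖g‖ := norm_pos_iff.2 hg
    rw [norm_mul, hi, hj]
    have hlex : toLex a + toLex b = toLex i + toLex j := congrArg toLex hab
    rcases lt_trichotomy (toLex i) (toLex a) with h | h | h
    · exact (mul_le_mul_of_nonneg_left (g.norm_coeff_le b) (norm_nonneg _)).trans_lt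
        (mul_lt_mul_of_pos_right (hi' a h) hg0)
    · rw [h] at hlex
      exact absurd (Prod.ext (toLex_inj.1 h.symm) (toLex_inj.1 (add_left_cancel hlex))) hne
    · have h' : toLex j < toLex b := by
        by_contra! hle
        exact (add_lt_add_of_lt_of_le h hle).ne hlex
      exact (mul_le_mul_of_nonneg_right (f.norm_coeff_le a) (norm_nonneg _)).trans_lt
        (mul_lt_mul_of_pos_left (hj' b h') hf0)

end GaussNorm

/-! ### The residue ring of the perfectoid Tate algebra -/

section Residue

variable (K : Type u) [NontriviallyNormedField K] [IsUltrametricDist K] (n p : ℕ)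
  [hp : Fact p.Prime]

/-- The map `K⟨X_1^{1/p^m}, …, X_n^{1/p^m}⟩ → K⟨X_1^{1/p^∞}, …, X_n^{1/p^∞}⟩`, the source being
written as the `m`-th copy of the Tate algebra. -/
def ofLevel (m : ℕ) : TateAlgebra K n →+* PerfTateAlgebra K n p :=
  (UniformSpace.Completion.coeRingHom (α := TateUnion K n p)).comp
    (DirectLimit.Ring.of (fun _ : ℕ => TateAlgebra K n) (transition K n p) m)

variable {K n p}

theorem norm_ofLevel (m : ℕ) (f : TateAlgebra K n) : ‖ofLevel K n p m f‖ = ‖f‖ :=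
  (UniformSpace.Completion.norm_coe (E := TateUnion K n p) _).trans rfl

theorem ofLevel_transition {i j : ℕ} (h : i ≤ j) (f : TateAlgebra K n) :
    ofLevel K n p j (transition K n p i j h f) = ofLevel K n p i f :=
  congrArg (UniformSpace.Completion.coeRingHom (α := TateUnion K n p))
    (DirectLimit.Ring.of_f (G := fun _ : ℕ => TateAlgebra K n) (f := transition K n p) h f)

theorem exists_norm_sub_ofLevel_lt (t : PerfTateAlgebra K n p) {ε : ℝ} (hε : 0 < ε) :
    ∃ m₀, ∀ m, m₀ ≤ m → ∃ f, ‖t - ofLevel K n p m f‖ < ε := by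
  obtain ⟨u, hu⟩ := UniformSpace.Completion.denseRange_coe.exists_dist_lt t hε
  obtain ⟨m₀, f, rfl⟩ : ∃ m₀ f, u = DirectLimit.Ring.of (fun _ : ℕ => TateAlgebra K n)
      (transition K n p) m₀ f :=
    DirectLimit.induction (transition K n p) (C := fun u => ∃ m₀ f,
      u = DirectLimit.Ring.of (fun _ : ℕ => TateAlgebra K n) (transition K n p) m₀ f)
      (fun i f => ⟨i, f, rfl⟩) u
  refine ⟨m₀, fun m hm => ⟨transition K n p m₀ m hm f, ?_⟩⟩
  rw [ofLevel_transition, ← dist_eq_norm]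
  exact hu

instance : IsUltrametricDist (PerfTateAlgebra K n p) :=
  IsUltrametricDist.isUltrametricDist_of_forall_norm_add_le_max_norm fun s t =>
    UniformSpace.Completion.induction_on₂ s t
      (isClosed_le (by fun_prop) (by fun_prop)) fun a b => by
        rw [← UniformSpace.Completion.coe_add, UniformSpace.Completion.norm_coe,
          UniformSpace.Completion.norm_coe, UniformSpace.Completion.norm_coe]
        exact IsUltrametricDist.norm_add_le_max a b

theorem PerfTateAlgebra.norm_mul_eq (s t : PerfTateAlgebra K n p) : ‖s * t‖ = ‖s‖ * ‖t‖ := by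
  have h : ∀ a b : TateUnion K n p, ‖a * b‖ = ‖a‖ * ‖b‖ :=
    DirectLimit.induction₂ (transition K n p) fun i f g => by
      refine (congrArg (unionNorm K n p) (DirectLimit.mul_def i f g)).trans ?_
      exact TateAlgebra.norm_mul_eq f g
  refine UniformSpace.Completion.induction_on₂ s t
    (isClosed_eq (by fun_prop) (by fun_prop)) fun a b => ?_
  rw [← UniformSpace.Completion.coe_mul, UniformSpace.Completion.norm_coe,
    UniformSpace.Completion.norm_coe, UniformSpace.Completion.norm_coe, h]

theorem PerfTateAlgebra.norm_pow_eq (t : PerfTateAlgebra K n p) (j : ℕ) : ‖t ^ j‖ = ‖t‖ ^ j := by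
  induction j with
  | zero =>
    rw [pow_zero, pow_zero, ← map_one (ofLevel K n p 0), norm_ofLevel]
    refine le_antisymm (TateAlgebra.norm_le fun t => ?_) ?_
    · by_cases h : t = 0 <;> simp [MvPowerSeries.coeff_one, h]
    · simpa using TateAlgebra.norm_coeff_le (1 : TateAlgebra K n) 0
  | succ j ih => rw [pow_succ, norm_mul_eq, ih, pow_succ]

theorem isTopologicallyNilpotent_iff_norm_lt_one (t : PerfTateAlgebra K n p) :
    IsTopologicallyNilpotent t ↔ ‖t‖ < 1 := by
  rw [IsTopologicallyNilpotent, tendsto_zero_iff_norm_tendsto_zero]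
  simp only [PerfTateAlgebra.norm_pow_eq]
  rw [tendsto_pow_atTop_nhds_zero_iff, abs_of_nonneg (norm_nonneg t)]

theorem exists_ne_zero_mem_of_mem_nhds_zero {V : Set (PerfTateAlgebra K n p)} (hV : V ∈ 𝓝 0) :
    ∃ v ∈ V, v ≠ 0 := by
  obtain ⟨ε, hε, hball⟩ := Metric.mem_nhds_iff.1 hV
  obtain ⟨c, hc, hcε⟩ := NormedField.exists_norm_lt K hε
  have hnorm : ‖(⟨MvPowerSeries.C c, MvPowerSeries.isRestricted_C _ c⟩ : TateAlgebra K n)‖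
      = ‖c‖ := by
    refine le_antisymm (TateAlgebra.norm_le fun t => ?_) ?_
    · classical
      rw [MvPowerSeries.coeff_C]
      split_ifs <;> simp
    · simpa using TateAlgebra.norm_coeff_le
        (⟨MvPowerSeries.C c, MvPowerSeries.isRestricted_C _ c⟩ : TateAlgebra K n) 0
  refine ⟨ofLevel K n p 0 ⟨MvPowerSeries.C c, MvPowerSeries.isRestricted_C _ c⟩, hball ?_, ?_⟩
  · rwa [mem_ball_zero_iff, norm_ofLevel, hnorm]
  · rw [← norm_pos_iff, norm_ofLevel, hnorm]
    exact hc

theorem isPowerBounded_iff_norm_le_one (t : PerfTateAlgebra K n p) :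
    IsPowerBounded t ↔ ‖t‖ ≤ 1 := by
  constructor
  · intro h
    obtain ⟨V, hV, hVt⟩ := h _ (Metric.ball_mem_nhds 0 one_pos)
    obtain ⟨v, hv, hv0⟩ := exists_ne_zero_mem_of_mem_nhds_zero hV
    by_contra! hlt
    obtain ⟨j, hj⟩ := pow_unbounded_of_one_lt ‖v‖⁻¹ hlt
    have h1 := hVt v hv j
    rw [mem_ball_zero_iff, PerfTateAlgebra.norm_mul_eq, PerfTateAlgebra.norm_pow_eq] at h1
    have h2 := (inv_lt_iff_one_lt_mul₀' (norm_pos_iff.2 hv0)).1 hj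
    exact h1.not_gt h2
  · intro h U hU
    obtain ⟨ε, hε, hball⟩ := Metric.mem_nhds_iff.1 hU
    refine ⟨Metric.ball 0 ε, Metric.ball_mem_nhds 0 hε, fun v hv j => hball ?_⟩
    rw [mem_ball_zero_iff] at hv ⊢
    rw [PerfTateAlgebra.norm_mul_eq, PerfTateAlgebra.norm_pow_eq]
    exact (mul_le_of_le_one_right (norm_nonneg _) (pow_le_one₀ (norm_nonneg _) h)).trans_lt hv

variable (K) in
/-- The ring of integers `{x | ‖x‖ ≤ 1}` of `K`. -/
abbrev normIntegers : ValuationSubring K := (NormedField.valuation (K := K)).valuationSubring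

theorem mem_normIntegers_iff {x : K} : x ∈ normIntegers K ↔ ‖x‖ ≤ 1 := by
  rw [Valuation.mem_valuationSubring_iff, NormedField.valuation_apply]
  exact Iff.rfl

theorem residue_eq_zero_iff_norm_lt_one (x : normIntegers K) :
    IsLocalRing.residue (normIntegers K) x = 0 ↔ ‖(x : K)‖ < 1 := by
  rw [IsLocalRing.residue_eq_zero_iff, IsLocalRing.mem_maximalIdeal, mem_nonunits_iff,
    ← not_le, not_iff_not]
  constructor
  · rintro ⟨u, rfl⟩
    have h : ((u : normIntegers K) : K) * ((u⁻¹ : (normIntegers K)ˣ) : normIntegers K) = 1 :=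
      congrArg Subtype.val u.mul_inv
    have h1 := congrArg norm h
    rw [norm_mul, norm_one] at h1
    rw [← h1]
    exact mul_le_of_le_one_right (norm_nonneg _) (mem_normIntegers_iff.1 (Subtype.prop _))
  · intro h
    have hx : (x : K) ≠ 0 := norm_pos_iff.1 (one_pos.trans_le h)
    refine IsUnit.of_mul_eq_one ⟨(x : K)⁻¹, mem_normIntegers_iff.2 ?_⟩
      (Subtype.ext (mul_inv_cancel₀ hx))
    rw [norm_inv]
    exact inv_le_one_of_one_le₀ h

variable (K n) in
/-- Polynomials with integral coefficients, as elements of the Tate algebra. -/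
def integralPolynomial : MvPolynomial (Fin n) (normIntegers K) →+* TateAlgebra K n :=
  RingHom.codRestrict
    (MvPolynomial.coeToMvPowerSeries.ringHom.comp (MvPolynomial.map (normIntegers K).subtype)) _
    fun f => by
      refine tendsto_nhds_of_eventually_eq (eventually_cofinite.2 ?_)
      refine f.support.finite_toSet.subset fun t ht => ?_
      by_contra h
      rw [Finset.mem_coe, MvPolynomial.notMem_support_iff] at h
      simp [MvPolynomial.coeff_map, h] at ht

theorem coeff_integralPolynomial (f : MvPolynomial (Fin n) (normIntegers K)) (t : Fin n →₀ ℕ) :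
    MvPowerSeries.coeff t (integralPolynomial K n f : MvPowerSeries (Fin n) K) = f.coeff t := by
  change MvPowerSeries.coeff t
    ((MvPolynomial.map (normIntegers K).subtype f : MvPolynomial (Fin n) K) :
      MvPowerSeries (Fin n) K) = _
  rw [MvPolynomial.coeff_coe, MvPolynomial.coeff_map]
  rfl

theorem norm_integralPolynomial_le_one (f : MvPolynomial (Fin n) (normIntegers K)) :
    ‖integralPolynomial K n f‖ ≤ 1 :=
  TateAlgebra.norm_le fun t => by
    rw [coeff_integralPolynomial]
    exact mem_normIntegers_iff.1 (f.coeff t).2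

theorem norm_integralPolynomial_lt_one_iff (f : MvPolynomial (Fin n) (normIntegers K)) :
    ‖integralPolynomial K n f‖ < 1 ↔
      MvPolynomial.map (IsLocalRing.residue (normIntegers K)) f = 0 := by
  constructor
  · intro h
    ext t
    rw [MvPolynomial.coeff_map, MvPolynomial.coeff_zero, residue_eq_zero_iff_norm_lt_one,
      ← coeff_integralPolynomial]
    exact (TateAlgebra.norm_coeff_le _ t).trans_lt h
  · intro h
    rcases eq_or_ne (integralPolynomial K n f) 0 with h0 | h0
    · simp [h0]
    · obtain ⟨i, hi, -⟩ := TateAlgebra.exists_max_norm_coeff h0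
      rw [← hi, coeff_integralPolynomial, ← residue_eq_zero_iff_norm_lt_one,
        ← MvPolynomial.coeff_map, h, MvPolynomial.coeff_zero]

/-- Only finitely many coefficients have norm at least `1 / 2`, and truncating the others changes
the series by an element of norm less than `1`. -/
theorem exists_norm_sub_integralPolynomial_lt_one (f : TateAlgebra K n) (hf : ‖f‖ ≤ 1) :
    ∃ g, ‖f - integralPolynomial K n g‖ < 1 := by
  classical
  have hfin := f.finite_le_norm_coeff (half_pos one_pos)
  let a : (Fin n →₀ ℕ) → normIntegers K := fun t =>
    ⟨MvPowerSeries.coeff t (f : MvPowerSeries (Fin n) K),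
      mem_normIntegers_iff.2 ((f.norm_coeff_le t).trans hf)⟩
  refine ⟨∑ t ∈ hfin.toFinset, MvPolynomial.monomial t (a t), lt_of_le_of_lt
    (TateAlgebra.norm_le (c := 1 / 2) fun t => ?_) one_half_lt_one⟩
  rw [AddSubgroupClass.coe_sub, map_sub, coeff_integralPolynomial, MvPolynomial.coeff_sum]
  simp only [MvPolynomial.coeff_monomial, Finset.sum_ite_eq']
  split_ifs with ht
  · simp [a]
  · have : ¬ 1 / 2 ≤ ‖MvPowerSeries.coeff t (f : MvPowerSeries (Fin n) K)‖ := fun h =>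
      ht (hfin.mem_toFinset.2 h)
    simpa using (not_le.1 this).le

variable (K n p) in
/-- The class in the residue ring of the element `f(X_1^{1/p^m}, …, X_n^{1/p^m})`, for a
polynomial `f` with integral coefficients. -/
def toResidueRing (m : ℕ) :
    MvPolynomial (Fin n) (normIntegers K) →+* ResidueRing (PerfTateAlgebra K n p) :=
  (Ideal.Quotient.mk _).comp <|
    RingHom.codRestrict ((ofLevel K n p m).comp (integralPolynomial K n)) (powerBounded _)
      fun f => (isPowerBounded_iff_norm_le_one _).2 <|
        (norm_ofLevel m _).trans_le (norm_integralPolynomial_le_one f)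

theorem mk_eq_toResidueRing_iff (m : ℕ) (t : powerBounded (PerfTateAlgebra K n p))
    (f : MvPolynomial (Fin n) (normIntegers K)) :
    Ideal.Quotient.mk _ t = toResidueRing K n p m f ↔
      ‖(t : PerfTateAlgebra K n p) - ofLevel K n p m (integralPolynomial K n f)‖ < 1 := by
  rw [toResidueRing, RingHom.comp_apply, Ideal.Quotient.eq]
  exact isTopologicallyNilpotent_iff_norm_lt_one _

theorem toResidueRing_eq_zero_iff (m : ℕ) (f : MvPolynomial (Fin n) (normIntegers K)) :
    toResidueRing K n p m f = 0 ↔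
      MvPolynomial.map (IsLocalRing.residue (normIntegers K)) f = 0 := by
  rw [eq_comm, ← map_zero (Ideal.Quotient.mk _), mk_eq_toResidueRing_iff, ← norm_neg, neg_sub,
    Subring.coe_zero, sub_zero, norm_ofLevel, norm_integralPolynomial_lt_one_iff]

theorem exists_mk_eq_toResidueRing (t : ResidueRing (PerfTateAlgebra K n p)) :
    ∃ m₀, ∀ m, m₀ ≤ m → t ∈ (toResidueRing K n p m).range := by
  obtain ⟨t, rfl⟩ := Ideal.Quotient.mk_surjective t
  obtain ⟨m₀, h⟩ := exists_norm_sub_ofLevel_lt (t : PerfTateAlgebra K n p) one_pos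
  refine ⟨m₀, fun m hm => ?_⟩
  obtain ⟨f, hf⟩ := h m hm
  have hf1 : ‖f‖ ≤ 1 := by
    rw [← norm_ofLevel (p := p) m f]
    have := IsUltrametricDist.norm_add_le_max (t : PerfTateAlgebra K n p)
      (-(t - ofLevel K n p m f))
    rw [← sub_eq_add_neg, sub_sub_cancel, norm_neg] at this
    exact this.trans (max_le ((isPowerBounded_iff_norm_le_one _).1 t.2) hf.le)
  obtain ⟨g, hg⟩ := exists_norm_sub_integralPolynomial_lt_one f hf1
  refine ⟨g, ((mk_eq_toResidueRing_iff m t g).2 ?_).symm⟩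
  have := IsUltrametricDist.norm_add_le_max (t - ofLevel K n p m f : PerfTateAlgebra K n p)
    (ofLevel K n p m (f - integralPolynomial K n g))
  rw [norm_ofLevel, map_sub, sub_add_sub_cancel] at this
  exact this.trans_lt (max_lt hf hg)

/-- The residue ring is the union over `m` of the polynomial rings over the residue field of `K` in
the variables `X_1^{1/p^m}, …, X_n^{1/p^m}`. -/
theorem IdempotentsSplit.residueRing :
    IdempotentsSplit (ResidueRing (PerfTateAlgebra K n p)) := by
  refine IdempotentsSplit.of_finite_subsets fun s => ?_
  choose m₀ hm₀ using exists_mk_eq_toResidueRing (K := K) (n := n) (p := p)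
  let m := s.sup m₀
  let ρ : MvPolynomial (Fin n) (normIntegers K) →+*
      MvPolynomial (Fin n) (IsLocalRing.ResidueField (normIntegers K)) :=
    MvPolynomial.map (IsLocalRing.residue (normIntegers K))
  have hρ : Function.Surjective ρ :=
    MvPolynomial.map_surjective _ (IsLocalRing.residue_surjective)
  have hker : RingHom.ker ρ = RingHom.ker (toResidueRing K n p m) := by
    ext f
    exact (toResidueRing_eq_zero_iff m f).symm
  refine ⟨_, inferInstance, ρ.liftOfSurjective hρ ⟨toResidueRing K n p m, hker.le⟩, ?_,
    IdempotentsSplit.mvPolynomial _ n, fun x hx => ?_⟩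
  · refine (injective_iff_map_eq_zero _).2 fun y hy => ?_
    obtain ⟨f, rfl⟩ := hρ y
    rw [RingHom.liftOfRightInverse_comp_apply] at hy
    exact RingHom.mem_ker.1 (hker.ge hy)
  · obtain ⟨f, rfl⟩ := hm₀ x m (Finset.le_sup hx)
    exact ⟨ρ f, RingHom.liftOfRightInverse_comp_apply _ _ _ _ _⟩

end Residue

end PerfTate

end PerfQS

end

theorem mainTheorem9 (p : ℕ) [Fact p.Prime] :
    (∀ (k : Type*) [Field k] (n r : ℕ), r ≤ n →
      ∀ (M : Type*) [AddCommGroup M] [Module (PerfQS.PerfLaurent k p n r) M]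
        [Module.Finite (PerfQS.PerfLaurent k p n r) M]
        [Module.Projective (PerfQS.PerfLaurent k p n r) M],
        Module.Free (PerfQS.PerfLaurent k p n r) M) ∧
    (∀ (K : Type*) [NontriviallyNormedField K] [IsUltrametricDist K],
      PerfQS.IsPerfectoidField p K → ∀ (n : ℕ),
      ∀ (M : Type*) [AddCommGroup M]
        [Module (PerfQS.ResidueRing (PerfQS.PerfTateAlgebra K n p)) M]
        [Module.Finite (PerfQS.ResidueRing (PerfQS.PerfTateAlgebra K n p)) M]
        [Module.Projective (PerfQS.ResidueRing (PerfQS.PerfTateAlgebra K n p)) M],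
        Module.Free (PerfQS.ResidueRing (PerfQS.PerfTateAlgebra K n p)) M) :=
  ⟨fun k _ _ _ h M _ _ _ _ => (PerfQS.IdempotentsSplit.perfLaurent_of_le k p h).free M,
    fun _ _ _ _ _ M _ _ _ _ => PerfQS.IdempotentsSplit.residueRing.free M⟩
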